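/- Let $G$ be a (finite-dimensional, real) Lie group acting smoothly and properly on a smooth finite-dimensional manifold $P$, where $P$ is Hausdorff, paracompact and without boundary; proper means that the map $G\times P\to P\times P$, $(g,p)\mapsto (g\cdot p,p)$, is proper. Let $\tau$ be a symplectic form on $P$ (a smooth, closed, nondegenerate 2-form) that is preserved by the action, i.e. $g^*\tau=\tau$ for all $g\in G$. Then there exists a $G$-invariant almost complex structure $J$ on $P$ (a smooth bundle endomorphism $J:TP\to TP$ with $J^2=-1$ and $J\circ dg=dg\circ J$ for all $g\in G$) which is adapted to $\tau$, i.e. $\tau(J\cdot,J\cdot)=\tau(\cdot,\cdot)$ and $\tau(\cdot,J\cdot)$ is a (smooth) Riemannian metric on $P$. -/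

import Mathlib

open scoped Manifold ContDiff

/-- A symplectic form on a smooth manifold `P` modelled on `E`: a smooth, alternating,
nondegenerate, closed field `τ` of bilinear forms on the tangent spaces. -/
structure SymplecticForm (E : Type*) [NormedAddCommGroup E] [NormedSpace ℝ E]
    (P : Type*) [TopologicalSpace P] [ChartedSpace E P] [IsManifold 𝓘(ℝ, E) ∞ P] where
  /-- The bilinear form on each tangent space. -/
  form (p : P) : TangentSpace 𝓘(ℝ, E) p →L[ℝ] TangentSpace 𝓘(ℝ, E) p →L[ℝ] ℝ
  contMDiff : ContMDiff 𝓘(ℝ, E) (𝓘(ℝ, E).prod 𝓘(ℝ, E →L[ℝ] E →L[ℝ] ℝ)) ∞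
    (fun p ↦ Bundle.TotalSpace.mk' (E →L[ℝ] E →L[ℝ] ℝ) p (form p))
  alternating (p : P) (v : TangentSpace 𝓘(ℝ, E) p) : form p v v = 0
  nondegenerate (p : P) (v : TangentSpace 𝓘(ℝ, E) p) (hv : ∀ w, form p v w = 0) : v = 0
  /-- The exterior derivative, evaluated on vector fields `X`, `Y`, `Z` that are smooth at `p`
  by the invariant formula, vanishes. -/
  closed (p : P) (X Y Z : ∀ q : P, TangentSpace 𝓘(ℝ, E) q)
    (hX : ContMDiffAt 𝓘(ℝ, E) (𝓘(ℝ, E).prod 𝓘(ℝ, E)) ∞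
      (fun q ↦ Bundle.TotalSpace.mk' E q (X q)) p)
    (hY : ContMDiffAt 𝓘(ℝ, E) (𝓘(ℝ, E).prod 𝓘(ℝ, E)) ∞
      (fun q ↦ Bundle.TotalSpace.mk' E q (Y q)) p)
    (hZ : ContMDiffAt 𝓘(ℝ, E) (𝓘(ℝ, E).prod 𝓘(ℝ, E)) ∞
      (fun q ↦ Bundle.TotalSpace.mk' E q (Z q)) p) :
    mvfderiv 𝓘(ℝ, E) (fun q ↦ form q (Y q) (Z q)) p (X p)
      - mvfderiv 𝓘(ℝ, E) (fun q ↦ form q (X q) (Z q)) p (Y p)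
      + mvfderiv 𝓘(ℝ, E) (fun q ↦ form q (X q) (Y q)) p (Z p)
      - form p (VectorField.mlieBracket 𝓘(ℝ, E) X Y p) (Z p)
      + form p (VectorField.mlieBracket 𝓘(ℝ, E) X Z p) (Y p)
      - form p (VectorField.mlieBracket 𝓘(ℝ, E) Y Z p) (X p) = 0

/-- An almost complex structure on a smooth manifold `P` modelled on `E`: a smooth bundle
endomorphism `J` of the tangent bundle with `J ∘ J = -1`. -/
structure AlmostComplexStructure (E : Type*) [NormedAddCommGroup E] [NormedSpace ℝ E]
    (P : Type*) [TopologicalSpace P] [ChartedSpace E P] [IsManifold 𝓘(ℝ, E) ∞ P] where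
  /-- The endomorphism of each tangent space. -/
  endo (p : P) : TangentSpace 𝓘(ℝ, E) p →L[ℝ] TangentSpace 𝓘(ℝ, E) p
  contMDiff : ContMDiff 𝓘(ℝ, E) (𝓘(ℝ, E).prod 𝓘(ℝ, E →L[ℝ] E)) ∞
    (fun p ↦ Bundle.TotalSpace.mk' (E →L[ℝ] E) p (endo p))
  endo_endo (p : P) (v : TangentSpace 𝓘(ℝ, E) p) : endo p (endo p v) = -v

section

variable {E : Type*} [NormedAddCommGroup E] [NormedSpace ℝ E]
  {P : Type*} [TopologicalSpace P] [ChartedSpace E P] [IsManifold 𝓘(ℝ, E) ∞ P]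

/-- The action of `G` on `P` preserves `τ`: `g^* τ = τ` for every `g`. -/
def SymplecticForm.IsInvariant (τ : SymplecticForm E P) (G : Type*) [Group G] [MulAction G P] :
    Prop :=
  ∀ (g : G) (p : P) (v w : TangentSpace 𝓘(ℝ, E) p),
    τ.form (g • p) (mfderiv 𝓘(ℝ, E) 𝓘(ℝ, E) (fun q : P ↦ g • q) p v)
      (mfderiv 𝓘(ℝ, E) 𝓘(ℝ, E) (fun q : P ↦ g • q) p w) = τ.form p v w

/-- `J` is invariant under the action of `G` on `P`: it commutes with the differential of the
action of every `g`. -/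
def AlmostComplexStructure.IsInvariant (J : AlmostComplexStructure E P) (G : Type*) [Group G]
    [MulAction G P] : Prop :=
  ∀ (g : G) (p : P) (v : TangentSpace 𝓘(ℝ, E) p),
    J.endo (g • p) (mfderiv 𝓘(ℝ, E) 𝓘(ℝ, E) (fun q : P ↦ g • q) p v) =
      mfderiv 𝓘(ℝ, E) 𝓘(ℝ, E) (fun q : P ↦ g • q) p (J.endo p v)

/-- `J` is adapted to `τ`: `τ(J·, J·) = τ` and `τ(·, J·)` is a (smooth) Riemannian metric. -/
structure AlmostComplexStructure.IsAdapted (J : AlmostComplexStructure E P)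
    (τ : SymplecticForm E P) : Prop where
  form_endo_endo (p : P) (v w : TangentSpace 𝓘(ℝ, E) p) :
    τ.form p (J.endo p v) (J.endo p w) = τ.form p v w
  exists_riemannianMetric :
    ∃ g : Bundle.ContMDiffRiemannianMetric 𝓘(ℝ, E) ∞ E (fun p : P ↦ TangentSpace 𝓘(ℝ, E) p),
      ∀ (p : P) (v w : TangentSpace 𝓘(ℝ, E) p), g.inner p v w = τ.form p v (J.endo p w)

end

section ParametricIntegral

open MeasureTheory Set Filter Topology

variable {E : Type*} [NormedAddCommGroup E] [NormedSpace ℝ E] [FiniteDimensional ℝ E]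
  {V : Type*} [NormedAddCommGroup V] [NormedSpace ℝ V]
  {X : Type*} [TopologicalSpace X] [MeasurableSpace X] [OpensMeasurableSpace X]
  {μ : Measure X} [IsFiniteMeasureOnCompacts μ]

/-- Differentiation under the integral sign over a compact set. -/
theorem hasFDerivAt_setIntegral_of_continuousOn [CompleteSpace V] {K : Set X} (hK : IsCompact K)
    (hKm : MeasurableSet K) {U : Set E} (hU : IsOpen U) {f : E → X → V} {f' : E → X → E →L[ℝ] V}
    (hf : ContinuousOn (fun q : E × X ↦ f q.1 q.2) (U ×ˢ K))
    (hf' : ContinuousOn (fun q : E × X ↦ f' q.1 q.2) (U ×ˢ K))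
    (hd : ∀ x ∈ U, ∀ a ∈ K, HasFDerivAt (f · a) (f' x a) x) {x : E} (hx : x ∈ U) :
    HasFDerivAt (fun x ↦ ∫ a in K, f x a ∂μ) (∫ a in K, f' x a ∂μ) x := by
  have : ProperSpace E := FiniteDimensional.proper ℝ E
  obtain ⟨r, hr, hrU⟩ := Metric.nhds_basis_closedBall.mem_iff.1 (hU.mem_nhds hx)
  obtain ⟨C, hC⟩ := ((isCompact_closedBall x r).prod hK).exists_bound_of_continuousOn
    (hf'.mono (prod_mono hrU Subset.rfl))
  have hslice : ∀ {W : Type _} [NormedAddCommGroup W] {k : E → X → W},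
      ContinuousOn (fun q : E × X ↦ k q.1 q.2) (U ×ˢ K) → ∀ y ∈ U, ContinuousOn (k y) K :=
    fun hk y hy ↦ hk.comp (by fun_prop : ContinuousOn (fun a : X ↦ (y, a)) K)
      fun a ha ↦ ⟨hy, ha⟩
  have hsl : ∀ y ∈ U, ContinuousOn (f y) K := fun y hy ↦
    hf.comp (by fun_prop : ContinuousOn (fun a : X ↦ (y, a)) K) fun a ha ↦ ⟨hy, ha⟩
  refine hasFDerivAt_integral_of_dominated_of_fderiv_le (bound := fun _ ↦ C)
    (Metric.closedBall_mem_nhds x hr) ?_ ((hsl x hx).integrableOn_compact' hK hKm)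
    ((hslice hf' x hx).aestronglyMeasurable_of_isCompact hK hKm) ?_ ?_ ?_
  · filter_upwards [hU.mem_nhds hx] with y hy
    exact (hsl y hy).aestronglyMeasurable_of_isCompact hK hKm
  · exact (ae_restrict_mem hKm).mono fun a ha y hy ↦ hC (y, a) ⟨hy, ha⟩
  · exact integrableOn_const hK.measure_lt_top.ne
  · exact (ae_restrict_mem hKm).mono fun a ha y hy ↦ hd y (hrU hy) a ha

theorem contDiffOn_setIntegral_of_hasFTaylorSeriesUpToOn [CompleteSpace V] {K : Set X}
    (hK : IsCompact K)
    (hKm : MeasurableSet K) {U : Set E} (hU : IsOpen U) {f : E → X → V}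
    {T : E → X → FormalMultilinearSeries ℝ E V}
    (hT : ∀ a ∈ K, HasFTaylorSeriesUpToOn ∞ (f · a) (T · a) U)
    (hc : ∀ m : ℕ, ContinuousOn (fun q : E × X ↦ T q.1 q.2 m) (U ×ˢ K)) :
    ContDiffOn ℝ ∞ (fun x ↦ ∫ a in K, f x a ∂μ) U := by
  have hint : ∀ m, ∀ x ∈ U, IntegrableOn (fun a ↦ T x a m) K μ := fun m x hx ↦
    ((hc m).comp (by fun_prop : ContinuousOn (fun a : X ↦ (x, a)) K)
      fun a ha ↦ ⟨hx, ha⟩).integrableOn_compact' hK hKm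
  have key : ∀ m : ℕ, ∀ x ∈ U, HasFDerivAt (fun x ↦ ∫ a in K, T x a m ∂μ)
      (∫ a in K, T x a (m + 1) ∂μ).curryLeft x := by
    intro m x hx
    have h := hasFDerivAt_setIntegral_of_continuousOn (μ := μ) hK hKm hU (hc m)
      (f' := fun x a ↦ (T x a (m + 1)).curryLeft)
      ((continuousMultilinearCurryLeftEquiv ℝ (fun _ : Fin (m + 1) ↦ E) V).continuous.comp_continuousOn
        (hc (m + 1)))
      (fun x hx a ha ↦ ((hT a ha).fderivWithin m (by exact_mod_cast ENat.natCast_lt_top m) x hx).hasFDerivAt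
        (hU.mem_nhds hx)) hx
    let L : ContinuousMultilinearMap ℝ (fun _ : Fin (m + 1) ↦ E) V →L[ℝ]
        E →L[ℝ] ContinuousMultilinearMap ℝ (fun _ : Fin m ↦ E) V :=
      (continuousMultilinearCurryLeftEquiv ℝ
        (fun _ : Fin (m + 1) ↦ E) V).toContinuousLinearEquiv
    have hL := ContinuousLinearMap.integral_comp_comm (𝕜 := ℝ)
      (Fₗ := E →L[ℝ] ContinuousMultilinearMap ℝ (fun _ : Fin m ↦ E) V) L (hint (m + 1) x hx)
    exact h.congr_fderiv hL
  have := HasFTaylorSeriesUpToOn.contDiffOn (n := ⊤) (f' := fun x m ↦ ∫ a in K, T x a m ∂μ)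
    (f := fun x ↦ ∫ a in K, f x a ∂μ) (s := U) (𝕜 := ℝ) ?_
  · exact this
  refine ⟨fun x hx ↦ ?_, fun m _ x hx ↦ (key m x hx).hasFDerivWithinAt,
    fun m _ x hx ↦ (key m x hx).continuousAt.continuousWithinAt⟩
  have h0 := ((ContinuousMultilinearMap.apply ℝ (fun _ : Fin 0 ↦ E) V 0).integral_comp_comm
      (hint 0 x hx))
  simp only [ContinuousMultilinearMap.curry0]
  refine h0.symm.trans (setIntegral_congr_fun hKm fun a ha ↦ ?_)
  exact (hT a ha).zero_eq x hx

/-- The integral over a compact set of a family of functions that depends smoothly on a parameter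
`x` is smooth in `x`. Joint smoothness is expressed through local coordinates `c` on the space of
integration. -/
theorem contDiffOn_setIntegral [CompleteSpace V] {K : Set X} (hK : IsCompact K)
    (hKm : MeasurableSet K) {U : Set E} (hU : IsOpen U) {f : E → X → V}
    {W : Type*} [NormedAddCommGroup W] [NormedSpace ℝ W]
    (hf : ∀ x ∈ U, ∀ a ∈ K, ∃ (c : X → W) (Ψ : E × W → V), ContinuousAt c a ∧
      ContDiffAt ℝ ∞ Ψ (x, c a) ∧ ∀ᶠ q : E × X in 𝓝 (x, a), f q.1 q.2 = Ψ (q.1, c q.2)) :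
    ContDiffOn ℝ ∞ (fun x ↦ ∫ a in K, f x a ∂μ) U := by
  refine contDiffOn_setIntegral_of_hasFTaylorSeriesUpToOn hK hKm hU
    (T := fun x a ↦ ftaylorSeriesWithin ℝ (f · a) U x) (fun a ha ↦ ?_) (fun m ↦ ?_)
  · refine ContDiffOn.ftaylorSeriesWithin (fun x hx ↦ ?_) hU.uniqueDiffOn
    obtain ⟨c, Ψ, -, hΨ, h⟩ := hf x hx a ha
    have h1 : ContDiffAt ℝ ∞ (fun y ↦ Ψ (y, c a)) x :=
      ContDiffAt.comp (f := fun y : E ↦ (y, c a)) x hΨ (by fun_prop)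
    have h2 : ∀ᶠ y in 𝓝 x, f y a = Ψ (y, c a) :=
      (by fun_prop : Continuous fun y : E ↦ (y, a)).continuousAt.eventually h
    exact (h1.congr_of_eventuallyEq h2).contDiffWithinAt
  · rintro ⟨x, a⟩ ⟨hx, ha⟩
    obtain ⟨c, Ψ, hc, hΨ, h⟩ := hf x hx a ha
    refine ContinuousAt.continuousWithinAt ?_
    have hpair : ContinuousAt (fun q : E × X ↦ (q.1, c q.2)) (x, a) :=
      continuousAt_fst.prodMk (ContinuousAt.comp (f := Prod.snd) (x := (x, a)) hc continuousAt_snd)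
    have hcont : ContinuousAt (fun q : E × X ↦ (iteratedFDeriv ℝ m Ψ
        (q.1, c q.2)).compContinuousLinearMap fun _ ↦ ContinuousLinearMap.inl ℝ E W) (x, a) := by
      refine ContinuousAt.comp (f := fun q : E × X ↦ iteratedFDeriv ℝ m Ψ (q.1, c q.2))
        (g := fun A : ContinuousMultilinearMap ℝ (fun _ : Fin m ↦ E × W) V ↦
          A.compContinuousLinearMap fun _ ↦ ContinuousLinearMap.inl ℝ E W)
        (ContinuousMultilinearMap.compContinuousLinearMapL _).continuous.continuousAt ?_
      exact ContinuousAt.comp (f := fun q : E × X ↦ (q.1, c q.2)) (x := (x, a))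
        (hΨ.continuousAt_iteratedFDeriv (k := m) (by exact_mod_cast le_top)) hpair
    refine hcont.congr ?_
    have hsm := hpair.eventually ((hΨ.of_le (m := (m : ℕ∞ω)) (by exact_mod_cast le_top)).eventually
      (by simp))
    have hUn : ∀ᶠ q : E × X in 𝓝 (x, a), q.1 ∈ U :=
      continuousAt_fst.eventually (hU.mem_nhds hx)
    filter_upwards [h.eventually_nhds, hsm, hUn] with q hq hqs hqU
    have h2 : (fun y ↦ f y q.2) =ᶠ[𝓝 q.1] (fun y ↦ Ψ (y, c q.2)) :=
      (by fun_prop : Continuous fun y : E ↦ (y, q.2)).continuousAt.eventually hq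
    simp only [ftaylorSeriesWithin]
    rw [iteratedFDerivWithin_of_isOpen m hU hqU, (Filter.EventuallyEq.iteratedFDeriv ℝ h2 m).eq_of_nhds]
    have h3 : (fun y ↦ Ψ (y, c q.2)) =
        (fun z ↦ Ψ (z + (0, c q.2))) ∘ ContinuousLinearMap.inl ℝ E W := by
      ext y; simp
    have h4 : ContDiffAt ℝ m (fun z ↦ Ψ (z + (0, c q.2))) (ContinuousLinearMap.inl ℝ E W q.1) :=
      ContDiffAt.comp (f := fun z : E × W ↦ z + (0, c q.2)) _ (by simpa using hqs) (by fun_prop)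
    obtain ⟨u, hu, hxu, hcu⟩ := h4.contDiffOn' (m := (m : ℕ∞ω)) le_rfl (by simp)
    simp only [insert_eq_of_mem (mem_univ _), univ_inter] at hcu
    have hpre : IsOpen (ContinuousLinearMap.inl ℝ E W ⁻¹' u) :=
      hu.preimage (ContinuousLinearMap.inl ℝ E W).continuous
    rw [h3, ← iteratedFDerivWithin_of_isOpen m hpre hxu,
      ContinuousLinearMap.iteratedFDerivWithin_comp_right _ hcu hu.uniqueDiffOn
      hpre.uniqueDiffOn hxu le_rfl, iteratedFDerivWithin_of_isOpen m hu hxu,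
      iteratedFDeriv_comp_add_right]
    simp

end ParametricIntegral

section InvSqrt

open MeasureTheory Set Filter Topology

variable {𝔸 : Type*} [NormedRing 𝔸] [NormedAlgebra ℝ 𝔸]

/-- The integrand of `invSqrt`. -/
noncomputable def invSqrtIntegrand (M : 𝔸) (t : ℝ) : 𝔸 :=
  Ring.inverse (algebraMap ℝ 𝔸 (t ^ 2) + M) + Ring.inverse (1 + t ^ 2 • M)

/-- The inverse square root of an element with positive spectrum, as an integral of resolvents. -/
noncomputable def invSqrt (M : 𝔸) : 𝔸 :=
  (2 / Real.pi) • ∫ t in Icc (0 : ℝ) 1, invSqrtIntegrand M t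

/-- The elements at which the integrand of `invSqrt` is regular. -/
def invSqrtDomain (𝔸 : Type*) [NormedRing 𝔸] [NormedAlgebra ℝ 𝔸] : Set 𝔸 :=
  {M | ∀ t ∈ Icc (0 : ℝ) 1, IsUnit (algebraMap ℝ 𝔸 (t ^ 2) + M) ∧ IsUnit (1 + t ^ 2 • M)}

theorem contDiffAt_invSqrtIntegrand [CompleteSpace 𝔸] {M : 𝔸} {t : ℝ}
    (h₁ : IsUnit (algebraMap ℝ 𝔸 (t ^ 2) + M)) (h₂ : IsUnit (1 + t ^ 2 • M)) :
    ContDiffAt ℝ ∞ (fun q : 𝔸 × ℝ ↦ invSqrtIntegrand q.1 q.2) (M, t) := by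
  obtain ⟨u, hu⟩ := h₁
  obtain ⟨v, hv⟩ := h₂
  have hu' := contDiffAt_ringInverse ℝ (n := ∞) u
  have hv' := contDiffAt_ringInverse ℝ (n := ∞) v
  rw [hu] at hu'
  rw [hv] at hv'
  refine ContDiffAt.add ?_ ?_
  · refine ContDiffAt.comp (f := fun q : 𝔸 × ℝ ↦ algebraMap ℝ 𝔸 (q.2 ^ 2) + q.1) (M, t) hu' ?_
    simp only [Algebra.algebraMap_eq_smul_one]
    fun_prop
  · refine ContDiffAt.comp (f := fun q : 𝔸 × ℝ ↦ 1 + q.2 ^ 2 • q.1) (M, t) hv' ?_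
    fun_prop

theorem isOpen_invSqrtDomain [CompleteSpace 𝔸] : IsOpen (invSqrtDomain 𝔸) := by
  refine isOpen_iff_mem_nhds.2 fun M hM ↦
    isCompact_Icc.eventually_forall_of_forall_eventually fun t ht ↦ ?_
  refine Filter.Eventually.and ?_ ?_
  · have : Continuous fun q : 𝔸 × ℝ ↦ algebraMap ℝ 𝔸 (q.2 ^ 2) + q.1 := by fun_prop
    exact this.continuousAt.eventually (Units.isOpen.mem_nhds (hM t ht).1)
  · have : Continuous fun q : 𝔸 × ℝ ↦ 1 + q.2 ^ 2 • q.1 := by fun_prop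
    exact this.continuousAt.eventually (Units.isOpen.mem_nhds (hM t ht).2)

theorem contDiffOn_invSqrt [FiniteDimensional ℝ 𝔸] :
    ContDiffOn ℝ ∞ (invSqrt : 𝔸 → 𝔸) (invSqrtDomain 𝔸) := by
  have : CompleteSpace 𝔸 := FiniteDimensional.complete ℝ 𝔸
  refine ContDiffOn.const_smul _ (contDiffOn_setIntegral (W := ℝ) isCompact_Icc measurableSet_Icc
    isOpen_invSqrtDomain fun M hM t ht ↦ ⟨id, fun q ↦ invSqrtIntegrand q.1 q.2, continuousAt_id,
      contDiffAt_invSqrtIntegrand (hM t ht).1 (hM t ht).2, .of_forall fun _ ↦ rfl⟩)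

theorem continuousOn_invSqrtIntegrand [CompleteSpace 𝔸] {M : 𝔸} (hM : M ∈ invSqrtDomain 𝔸) :
    ContinuousOn (invSqrtIntegrand M) (Icc 0 1) := fun t ht ↦
  (ContinuousAt.comp (f := fun s : ℝ ↦ (M, s))
    (contDiffAt_invSqrtIntegrand (hM t ht).1 (hM t ht).2).continuousAt
    (by fun_prop)).continuousWithinAt

theorem apply_invSqrt [CompleteSpace 𝔸] {M : 𝔸} (hM : M ∈ invSqrtDomain 𝔸)
    {V : Type*} [NormedAddCommGroup V] [NormedSpace ℝ V] [CompleteSpace V] (L : 𝔸 →L[ℝ] V) :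
    L (invSqrt M) = (2 / Real.pi) • ∫ t in Icc (0 : ℝ) 1, L (invSqrtIntegrand M t) := by
  rw [invSqrt, map_smul, L.integral_comp_comm
    ((continuousOn_invSqrtIntegrand hM).integrableOn_compact isCompact_Icc)]

theorem map_ringInverse_of_mulEquiv {R S : Type*} [Ring R] [Ring S] (φ : R ≃+* S) (a : R) :
    Ring.inverse (φ a) = φ (Ring.inverse a) := by
  by_cases ha : IsUnit a
  · obtain ⟨u, rfl⟩ := ha
    rw [Ring.inverse_unit]
    exact Ring.inverse_unit (Units.map (φ : R →* S) u)
  · rw [Ring.inverse_non_unit _ ha, Ring.inverse_non_unit, map_zero]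
    rwa [MulEquiv.isUnit_map φ]

theorem map_invSqrt {𝔹 : Type*} [NormedRing 𝔹] [NormedAlgebra ℝ 𝔹]
    (φ : 𝔸 ≃A[ℝ] 𝔹) (M : 𝔸) : invSqrt (φ M) = φ (invSqrt M) := by
  have h : ∀ t, invSqrtIntegrand (φ M) t = φ (invSqrtIntegrand M t) := fun t ↦ by
    have e₁ : algebraMap ℝ 𝔹 (t ^ 2) + φ M = φ (algebraMap ℝ 𝔸 (t ^ 2) + M) := by
      rw [map_add, AlgHomClass.commutes]
    have e₂ : 1 + t ^ 2 • φ M = φ (1 + t ^ 2 • M) := by simp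
    have h₁ := map_ringInverse_of_mulEquiv (φ : 𝔸 ≃+* 𝔹)
    rw [invSqrtIntegrand, invSqrtIntegrand, e₁, e₂, map_add φ (Ring.inverse _)]
    exact congrArg₂ _ (h₁ _) (h₁ _)
  have := ContinuousLinearEquiv.integral_comp_comm (𝕜 := ℝ)
    (φ.toContinuousLinearEquiv : 𝔸 ≃L[ℝ] 𝔹) (μ := volume.restrict (Icc (0 : ℝ) 1))
    (invSqrtIntegrand M)
  simp only [invSqrt, h]
  rw [map_smul]
  exact congrArg _ this

theorem commute_invSqrt [CompleteSpace 𝔸] {M A : 𝔸} (hM : M ∈ invSqrtDomain 𝔸) (h : Commute A M) :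
    Commute A (invSqrt M) := by
  have hinv : ∀ {a : 𝔸}, IsUnit a → Commute A a → Commute A (Ring.inverse a) := by
    rintro _ ⟨u, rfl⟩ hc
    rw [Ring.inverse_unit]
    exact hc.units_inv_right
  have h₁ := apply_invSqrt hM (ContinuousLinearMap.mul ℝ 𝔸 A)
  have h₂ := apply_invSqrt hM ((ContinuousLinearMap.mul ℝ 𝔸).flip A)
  simp only [ContinuousLinearMap.mul_apply', ContinuousLinearMap.flip_apply] at h₁ h₂
  rw [Commute, SemiconjBy, h₁, h₂]
  congr 1
  refine setIntegral_congr_fun measurableSet_Icc fun t ht ↦ ?_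
  refine Commute.add_right (hinv (hM t ht).1 ?_) (hinv (hM t ht).2 ?_)
  · exact (Algebra.commute_algebraMap_right _ _).add_right h
  · exact (Commute.one_right _).add_right (h.smul_right _)

theorem setIntegral_inv_add_inv {l : ℝ} (hl : 0 < l) :
    ∫ t in Icc (0 : ℝ) 1, ((t ^ 2 + l)⁻¹ + (1 + t ^ 2 * l)⁻¹) = Real.pi / 2 * (√l)⁻¹ := by
  obtain ⟨c, hc, rfl⟩ : ∃ c : ℝ, 0 < c ∧ c ^ 2 = l := ⟨√l, by positivity, Real.sq_sqrt hl.le⟩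
  rw [integral_Icc_eq_integral_Ioc, ← intervalIntegral.integral_of_le zero_le_one,
    Real.sqrt_sq hc.le]
  have e : ∀ t : ℝ, (1 + t ^ 2 * c ^ 2)⁻¹ = (c ^ 2)⁻¹ * (c⁻¹ ^ 2 + t ^ 2)⁻¹ := fun t ↦ by
    rw [← mul_inv]; congr 1; field_simp
  simp only [e, add_comm _ (c ^ 2)]
  rw [intervalIntegral.integral_add, intervalIntegral.integral_const_mul,
    integral_inv_sq_add_sq hc.ne', integral_inv_sq_add_sq (inv_ne_zero hc.ne')]
  · have := Real.arctan_inv_of_pos hc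
    simp only [zero_div, Real.arctan_zero, one_div, inv_inv, sub_zero, this]
    field_simp
    ring
  · exact (Continuous.inv₀ (by fun_prop) fun t ↦ by positivity).intervalIntegrable _ _
  · exact (Continuous.mul (by fun_prop)
      (Continuous.inv₀ (by fun_prop) fun t ↦ by positivity)).intervalIntegrable _ _

end InvSqrt

section Polar

open MeasureTheory Set Filter Topology

/-- An endomorphism that is self-adjoint for some inner product is diagonalizable. -/
theorem iSup_eigenspace_eq_top_of_symm {F : Type*} [AddCommGroup F] [Module ℝ F]
    [FiniteDimensional ℝ F] (B : F →ₗ[ℝ] F →ₗ[ℝ] ℝ) (hs : ∀ v w, B v w = B w v)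
    (hp : ∀ v, v ≠ 0 → 0 < B v v) (T : F →ₗ[ℝ] F) (hT : ∀ v w, B (T v) w = B v (T w)) :
    ⨆ μ, Module.End.eigenspace T μ = ⊤ := by
  let c : InnerProductSpace.Core ℝ F :=
    { inner := fun v w ↦ B v w
      conj_inner_symm := fun v w ↦ hs w v
      re_inner_nonneg := fun v ↦ by
        rcases eq_or_ne v 0 with rfl | hv
        · simp
        · simpa using (hp v hv).le
      add_left := fun v w x ↦ by simp
      smul_left := fun v w r ↦ by simp
      definite := fun v hv ↦ by
        by_contra h
        exact (hp v h).ne' hv }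
  let : NormedAddCommGroup F := c.toNormedAddCommGroup
  let : InnerProductSpace ℝ F := InnerProductSpace.ofCore c.toCore
  have hsym : T.IsSymmetric := hT
  exact Submodule.orthogonal_eq_bot_iff.1 hsym.orthogonalComplement_iSup_eigenspaces_eq_bot

variable {E : Type*} [NormedAddCommGroup E] [NormedSpace ℝ E]

/-- An inner product `h` together with a linear symplectic form `τ`. -/
structure IsInnerSymplecticPair (h τ : E →L[ℝ] E →L[ℝ] ℝ) : Prop where
  symm (v w : E) : h v w = h w v
  pos (v : E) (hv : v ≠ 0) : 0 < h v v
  alternating (v : E) : τ v v = 0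
  nondegenerate (v : E) (hv : ∀ w, τ v w = 0) : v = 0

/-- The endomorphism `A` with `h (A v) w = τ v w`. -/
noncomputable def polarEndo (h τ : E →L[ℝ] E →L[ℝ] ℝ) : E →L[ℝ] E := h.inverse ∘L τ

/-- The complex structure `A (-A²)^(-1/2)` in the polar decomposition of `A = polarEndo h τ`. -/
noncomputable def polarComplex (h τ : E →L[ℝ] E →L[ℝ] ℝ) : E →L[ℝ] E :=
  polarEndo h τ * invSqrt (-(polarEndo h τ * polarEndo h τ))

theorem isInvertible_of_pos [FiniteDimensional ℝ E] {h : E →L[ℝ] E →L[ℝ] ℝ}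
    (hp : ∀ v, v ≠ 0 → 0 < h v v) : h.IsInvertible := by
  have hinj : Function.Injective (h : E →ₗ[ℝ] E →L[ℝ] ℝ) := by
    refine (injective_iff_map_eq_zero _).2 fun v hv ↦ ?_
    by_contra hne
    have := hp v hne
    rw [show h v = 0 from hv] at this
    simp at this
  have hdim : Module.finrank ℝ E = Module.finrank ℝ (E →L[ℝ] ℝ) := by
    rw [← (LinearMap.toContinuousLinearMap : (E →ₗ[ℝ] ℝ) ≃ₗ[ℝ] E →L[ℝ] ℝ).finrank_eq]
    exact Subspace.dual_finrank_eq.symm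
  refine ⟨(LinearEquiv.ofInjectiveOfFinrankEq (h : E →ₗ[ℝ] E →L[ℝ] ℝ) hinj
    hdim).toContinuousLinearEquiv, ?_⟩
  ext v w
  rfl

theorem polarComplex_bilinearComp (h τ : E →L[ℝ] E →L[ℝ] ℝ) (e : E ≃L[ℝ] E) :
    polarComplex (h.bilinearComp (e : E →L[ℝ] E) (e : E →L[ℝ] E))
      (τ.bilinearComp (e : E →L[ℝ] E) (e : E →L[ℝ] E)) =
      e.symm ∘L polarComplex h τ ∘L e := by
  let d : (E →L[ℝ] ℝ) ≃L[ℝ] (E →L[ℝ] ℝ) := e.symm.arrowCongr (.refl ℝ ℝ)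
  have hb : ∀ k : E →L[ℝ] E →L[ℝ] ℝ, k.bilinearComp (e : E →L[ℝ] E) (e : E →L[ℝ] E) =
      (d : (E →L[ℝ] ℝ) →L[ℝ] (E →L[ℝ] ℝ)) ∘L (k ∘L (e : E →L[ℝ] E)) := fun k ↦ by
    ext v w; simp [d]
  have hA : polarEndo (h.bilinearComp (e : E →L[ℝ] E) (e : E →L[ℝ] E))
      (τ.bilinearComp (e : E →L[ℝ] E) (e : E →L[ℝ] E)) =
      e.symm.conjContinuousAlgEquiv (polarEndo h τ) := by
    rw [polarEndo, hb h, hb τ, ContinuousLinearMap.inverse_equiv_comp,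
      ContinuousLinearMap.inverse_comp_equiv]
    ext v
    simp [polarEndo]
  rw [polarComplex, hA, ← map_mul, ← map_neg, map_invSqrt, ← map_mul]
  rfl

namespace IsInnerSymplecticPair

variable {h τ : E →L[ℝ] E →L[ℝ] ℝ}

theorem skew (H : IsInnerSymplecticPair h τ) (v w : E) : τ v w = -τ w v := by
  have := H.alternating (v + w)
  simp only [map_add, add_apply, H.alternating] at this
  linarith

theorem bilin_apply_ringInverse {X : E →L[ℝ] E} (hX : IsUnit X)
    (hs : ∀ v w, h (X v) w = h v (X w)) (v w : E) :
    h (Ring.inverse X v) w = h v (Ring.inverse X w) := by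
  have e : ∀ u, X (Ring.inverse X u) = u := fun u ↦ DFunLike.congr_fun (Ring.mul_inverse_cancel X hX) u
  rw [← congrArg (h (Ring.inverse X v)) (e w), ← hs, e]

theorem ringInverse_pos {X : E →L[ℝ] E} (hX : IsUnit X) (H : IsInnerSymplecticPair h τ)
    (hp : ∀ v, v ≠ 0 → 0 < h (X v) v) {v : E} (hv : v ≠ 0) : 0 < h (Ring.inverse X v) v := by
  have e : X (Ring.inverse X v) = v := DFunLike.congr_fun (Ring.mul_inverse_cancel X hX) v
  have h0 : Ring.inverse X v ≠ 0 := fun h0 ↦ hv (by rw [← e, h0, map_zero])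
  have := hp _ h0
  rwa [e, H.symm] at this

variable [FiniteDimensional ℝ E]

theorem apply_polarEndo (H : IsInnerSymplecticPair h τ) (v w : E) :
    h (polarEndo h τ v) w = τ v w := by
  have := (isInvertible_of_pos H.pos).self_apply_inverse (τ v)
  exact DFunLike.congr_fun this w

theorem apply_polarEndo_right (H : IsInnerSymplecticPair h τ) (v w : E) :
    h v (polarEndo h τ w) = -h (polarEndo h τ v) w := by
  rw [H.symm, H.apply_polarEndo, H.apply_polarEndo, H.skew]

theorem polarEndo_ne_zero (H : IsInnerSymplecticPair h τ) {v : E} (hv : v ≠ 0) :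
    polarEndo h τ v ≠ 0 := fun h0 ↦
  hv (H.nondegenerate v fun w ↦ by rw [← H.apply_polarEndo, h0]; simp)

theorem apply_neg_sq (H : IsInnerSymplecticPair h τ) (v w : E) :
    h ((-(polarEndo h τ * polarEndo h τ)) v) w = h (polarEndo h τ v) (polarEndo h τ w) := by
  rw [H.apply_polarEndo_right]
  simp

theorem isUnit_of_bilin_pos {X : E →L[ℝ] E}
    (hX : ∀ v, v ≠ 0 → 0 < h (X v) v) : IsUnit X := by
  have hinj : Function.Injective X := (injective_iff_map_eq_zero X).2 fun v hv ↦ by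
    by_contra hne
    have := hX v hne
    simp [hv] at this
  rw [ContinuousLinearMap.isUnit_iff_bijective]
  exact ⟨hinj, (LinearMap.injective_iff_surjective (f := (X : E →ₗ[ℝ] E))).1 hinj⟩

theorem pos_fst (H : IsInnerSymplecticPair h τ) (t : ℝ) {v : E} (hv : v ≠ 0) :
    0 < h ((algebraMap ℝ (E →L[ℝ] E) (t ^ 2) + -(polarEndo h τ * polarEndo h τ)) v) v := by
  rw [add_apply, map_add, add_apply, H.apply_neg_sq]
  have h₁ := H.pos _ (H.polarEndo_ne_zero hv)
  have h₂ := H.pos v hv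
  have : h (algebraMap ℝ (E →L[ℝ] E) (t ^ 2) v) v = t ^ 2 * h v v := by
    simp [Algebra.algebraMap_eq_smul_one]
  rw [this]
  positivity

theorem pos_snd (H : IsInnerSymplecticPair h τ) (t : ℝ) {v : E} (hv : v ≠ 0) :
    0 < h ((1 + t ^ 2 • -(polarEndo h τ * polarEndo h τ) : E →L[ℝ] E) v) v := by
  rw [add_apply, map_add, add_apply, smul_apply, map_smul, smul_apply, H.apply_neg_sq]
  have h₁ := H.pos _ (H.polarEndo_ne_zero hv)
  have h₂ := H.pos v hv
  simp only [one_apply_eq_self, smul_eq_mul]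
  positivity

theorem mem_invSqrtDomain (H : IsInnerSymplecticPair h τ) :
    -(polarEndo h τ * polarEndo h τ) ∈ invSqrtDomain (E →L[ℝ] E) := fun t _ ↦
  ⟨isUnit_of_bilin_pos (h := h) fun _ hv ↦ H.pos_fst t hv, isUnit_of_bilin_pos (h := h) fun _ hv ↦ H.pos_snd t hv⟩

theorem symm_invSqrt (H : IsInnerSymplecticPair h τ) (v w : E) :
    h (invSqrt (-(polarEndo h τ * polarEndo h τ)) v) w =
      h v (invSqrt (-(polarEndo h τ * polarEndo h τ)) w) := by
  have : CompleteSpace E := FiniteDimensional.complete ℝ E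
  have h₁ := apply_invSqrt H.mem_invSqrtDomain
    ((h.flip w).comp (ContinuousLinearMap.apply ℝ E v))
  have h₂ := apply_invSqrt H.mem_invSqrtDomain
    ((h v).comp (ContinuousLinearMap.apply ℝ E w))
  simp only [ContinuousLinearMap.comp_apply, ContinuousLinearMap.apply_apply,
    ContinuousLinearMap.flip_apply] at h₁ h₂
  rw [h₁, h₂]
  congr 1
  refine setIntegral_congr_fun measurableSet_Icc fun t ht ↦ ?_
  have hu := H.mem_invSqrtDomain t ht
  simp only [invSqrtIntegrand, add_apply, map_add]
  rw [bilin_apply_ringInverse hu.1, bilin_apply_ringInverse hu.2]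
  · intro v w
    simp [H.apply_polarEndo_right]
  · intro v w
    simp [H.apply_polarEndo_right, Algebra.algebraMap_eq_smul_one]

theorem invSqrt_pos (H : IsInnerSymplecticPair h τ) {v : E} (hv : v ≠ 0) :
    0 < h (invSqrt (-(polarEndo h τ * polarEndo h τ)) v) v := by
  have : CompleteSpace E := FiniteDimensional.complete ℝ E
  have h₁ := apply_invSqrt H.mem_invSqrtDomain
    ((h.flip v).comp (ContinuousLinearMap.apply ℝ E v))
  simp only [ContinuousLinearMap.comp_apply, ContinuousLinearMap.apply_apply,
    ContinuousLinearMap.flip_apply] at h₁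
  rw [h₁]
  have hc : ContinuousOn (fun t ↦ h (invSqrtIntegrand (-(polarEndo h τ * polarEndo h τ)) t v) v)
      (Icc 0 1) :=
    ((h.flip v).comp (ContinuousLinearMap.apply ℝ E v)).continuous.comp_continuousOn
      (continuousOn_invSqrtIntegrand H.mem_invSqrtDomain)
  refine mul_pos (by positivity) ?_
  rw [integral_Icc_eq_integral_Ioc, ← intervalIntegral.integral_of_le zero_le_one]
  refine intervalIntegral.intervalIntegral_pos_of_pos_on (hc.intervalIntegrable_of_Icc zero_le_one)
    (fun t ht ↦ ?_) zero_lt_one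
  have hu := H.mem_invSqrtDomain t (Ioo_subset_Icc_self ht)
  simp only [invSqrtIntegrand, add_apply, map_add]
  exact add_pos (ringInverse_pos hu.1 H (fun _ ↦ H.pos_fst t) hv)
    (ringInverse_pos hu.2 H (fun _ ↦ H.pos_snd t) hv)

theorem invSqrt_apply_of_eigenvector (H : IsInnerSymplecticPair h τ) {v : E} {l : ℝ} (hl : 0 < l)
    (hv : (-(polarEndo h τ * polarEndo h τ)) v = l • v) :
    invSqrt (-(polarEndo h τ * polarEndo h τ)) v = (√l)⁻¹ • v := by
  have : CompleteSpace E := FiniteDimensional.complete ℝ E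
  have h₁ := apply_invSqrt H.mem_invSqrtDomain (ContinuousLinearMap.apply ℝ E v)
  simp only [ContinuousLinearMap.apply_apply] at h₁
  have hinv : ∀ {X : E →L[ℝ] E} {c : ℝ}, IsUnit X → c ≠ 0 → X v = c • v →
      Ring.inverse X v = c⁻¹ • v := fun {X c} hX hc hXv ↦ by
    have e : Ring.inverse X (X v) = v := DFunLike.congr_fun (Ring.inverse_mul_cancel X hX) v
    rw [hXv, map_smul] at e
    rw [← congrArg (c⁻¹ • ·) e]
    simp [smul_smul, hc]
  have h₂ : ∀ t ∈ Icc (0 : ℝ) 1, invSqrtIntegrand (-(polarEndo h τ * polarEndo h τ)) t v =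
      ((t ^ 2 + l)⁻¹ + (1 + t ^ 2 * l)⁻¹) • v := fun t ht ↦ by
    have hu := H.mem_invSqrtDomain t ht
    rw [invSqrtIntegrand, add_apply, add_smul]
    refine congrArg₂ _ (hinv hu.1 (by positivity) ?_) (hinv hu.2 (by positivity) ?_)
    · rw [add_apply, hv]
      simp [Algebra.algebraMap_eq_smul_one, add_smul]
    · rw [add_apply, smul_apply, hv]
      simp [add_smul, smul_smul]
  rw [h₁, setIntegral_congr_fun measurableSet_Icc h₂, integral_smul_const,
    setIntegral_inv_add_inv hl, smul_smul]
  congr 1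
  field_simp

theorem invSqrt_invSqrt_apply (H : IsInnerSymplecticPair h τ) (v : E) :
    invSqrt (-(polarEndo h τ * polarEndo h τ)) (invSqrt (-(polarEndo h τ * polarEndo h τ))
      ((-(polarEndo h τ * polarEndo h τ)) v)) = v := by
  set M := -(polarEndo h τ * polarEndo h τ) with hM
  have hMs : ∀ v w, h (M v) w = h v (M w) := fun v w ↦ by
    rw [hM, H.apply_neg_sq, H.symm v, H.apply_neg_sq, H.symm]
  have htop := iSup_eigenspace_eq_top_of_symm (F := E)
    ((ContinuousLinearMap.coeLM ℝ).comp (h : E →ₗ[ℝ] E →L[ℝ] ℝ)) H.symm H.pos (M : E →ₗ[ℝ] E) hMs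
  have hle : ⨆ μ, Module.End.eigenspace (M : E →ₗ[ℝ] E) μ ≤
      LinearMap.eqLocus ((invSqrt M * invSqrt M * M : E →L[ℝ] E) : E →ₗ[ℝ] E) LinearMap.id := by
    refine iSup_le fun l v hv ↦ ?_
    rcases eq_or_ne v 0 with rfl | hv0
    · exact Submodule.zero_mem _
    have hv' : M v = l • v := Module.End.mem_eigenspace_iff.1 hv
    have hl : 0 < l := by
      have h₁ := H.pos _ (H.polarEndo_ne_zero hv0)
      rw [← H.apply_neg_sq, ← hM, hv', map_smul, smul_apply, smul_eq_mul] at h₁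
      exact pos_of_mul_pos_left h₁ (H.pos v hv0).le
    have hR := H.invSqrt_apply_of_eigenvector hl hv'
    rw [← hM] at hR
    have hsq : l * ((√l)⁻¹ * (√l)⁻¹) = 1 := by
      rw [← mul_inv, Real.mul_self_sqrt hl.le, mul_inv_cancel₀ hl.ne']
    simp [LinearMap.mem_eqLocus, hv', hR, smul_smul, hsq]
  rw [htop] at hle
  exact hle (Submodule.mem_top (x := v))

theorem commute_polarEndo_invSqrt (H : IsInnerSymplecticPair h τ) :
    Commute (polarEndo h τ) (invSqrt (-(polarEndo h τ * polarEndo h τ))) := by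
  have : CompleteSpace E := FiniteDimensional.complete ℝ E
  exact commute_invSqrt H.mem_invSqrtDomain
    ((Commute.refl _).mul_right (Commute.refl _)).neg_right

theorem polarComplex_polarComplex (H : IsInnerSymplecticPair h τ) (v : E) :
    polarComplex h τ (polarComplex h τ v) = -v := by
  have hc : ∀ u, invSqrt (-(polarEndo h τ * polarEndo h τ)) (polarEndo h τ u) =
      polarEndo h τ (invSqrt (-(polarEndo h τ * polarEndo h τ)) u) :=
    fun u ↦ (DFunLike.congr_fun H.commute_polarEndo_invSqrt u).symm
  have := H.invSqrt_invSqrt_apply v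
  simp only [neg_apply, mul_apply_eq_comp, map_neg, hc] at this
  simp only [polarComplex, mul_apply_eq_comp, hc]
  rw [← this, neg_neg]
  simp [this]

theorem apply_polarComplex_pos (H : IsInnerSymplecticPair h τ) {v : E} (hv : v ≠ 0) :
    0 < τ v (polarComplex h τ v) := by
  have hc := DFunLike.congr_fun H.commute_polarEndo_invSqrt v
  rw [← H.apply_polarEndo, H.symm, polarComplex, hc]
  exact H.invSqrt_pos (H.polarEndo_ne_zero hv)

theorem apply_polarComplex_polarComplex (H : IsInnerSymplecticPair h τ) (v w : E) :
    τ (polarComplex h τ v) (polarComplex h τ w) = τ v w := by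
  have key : ∀ v w, τ (polarComplex h τ v) w = -τ v (polarComplex h τ w) := fun v w ↦ by
    have hc : ∀ u, polarEndo h τ (invSqrt (-(polarEndo h τ * polarEndo h τ)) u) =
        invSqrt (-(polarEndo h τ * polarEndo h τ)) (polarEndo h τ u) :=
      fun u ↦ DFunLike.congr_fun H.commute_polarEndo_invSqrt u
    rw [← H.apply_polarEndo, ← H.apply_polarEndo, polarComplex]
    simp only [mul_apply_eq_comp]
    rw [H.apply_polarEndo_right, neg_neg, ← H.symm_invSqrt, hc, hc]
  rw [key, H.polarComplex_polarComplex]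
  simp

theorem contDiffAt_polarComplex (H : IsInnerSymplecticPair h τ) :
    ContDiffAt ℝ ∞ (fun q : (E →L[ℝ] E →L[ℝ] ℝ) × (E →L[ℝ] E →L[ℝ] ℝ) ↦ polarComplex q.1 q.2)
      (h, τ) := by
  have : CompleteSpace E := FiniteDimensional.complete ℝ E
  have hA : ContDiffAt ℝ ∞ (fun q : (E →L[ℝ] E →L[ℝ] ℝ) × (E →L[ℝ] E →L[ℝ] ℝ) ↦
      polarEndo q.1 q.2) (h, τ) := by
    refine ContDiffAt.clm_comp ?_ contDiffAt_snd
    obtain ⟨e, he⟩ := isInvertible_of_pos H.pos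
    exact ContDiffAt.comp (f := Prod.fst) (h, τ) (he ▸ contDiffAt_map_inverse e) contDiffAt_fst
  refine ContDiffAt.clm_comp hA ?_
  exact ContDiffAt.comp (f := fun q : (E →L[ℝ] E →L[ℝ] ℝ) × (E →L[ℝ] E →L[ℝ] ℝ) ↦
      -(polarEndo q.1 q.2 * polarEndo q.1 q.2)) (h, τ)
    (contDiffOn_invSqrt.contDiffAt (isOpen_invSqrtDomain.mem_nhds H.mem_invSqrtDomain))
    (hA.clm_comp hA).neg

end IsInnerSymplecticPair

end Polar

section FormVia

variable {E : Type*} [NormedAddCommGroup E] [NormedSpace ℝ E]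
  {V : Type*} [AddCommGroup V] [Module ℝ V] [TopologicalSpace V] [IsTopologicalAddGroup V]
  [ContinuousSMul ℝ V]
  {W : Type*} [AddCommGroup W] [Module ℝ W] [TopologicalSpace W] [IsTopologicalAddGroup W]
  [ContinuousSMul ℝ W]

/-- Transport of bilinear forms along a linear equivalence. -/
noncomputable def formVia (e : V ≃L[ℝ] E) :
    (V →L[ℝ] V →L[ℝ] ℝ) ≃L[ℝ] (E →L[ℝ] E →L[ℝ] ℝ) :=
  e.arrowCongr (e.arrowCongr (.refl ℝ ℝ))

@[simp]
theorem formVia_apply (e : V ≃L[ℝ] E) (B : V →L[ℝ] V →L[ℝ] ℝ) (v w : E) :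
    formVia e B v w = B (e.symm v) (e.symm w) := by
  simp [formVia]

/-- The polar complex structure of a pair of forms on a topological vector space `V`, transported
along an equivalence of `V` with a normed space. -/
noncomputable def polarVia (e : V ≃L[ℝ] E) (h τ : V →L[ℝ] V →L[ℝ] ℝ) : V →L[ℝ] V :=
  e.symm ∘L polarComplex (formVia e h) (formVia e τ) ∘L e

theorem polarVia_trans (d : V ≃L[ℝ] W) (e : W ≃L[ℝ] E) {h τ : V →L[ℝ] V →L[ℝ] ℝ}
    {h' τ' : W →L[ℝ] W →L[ℝ] ℝ} (hh : ∀ v w, h' (d v) (d w) = h v w)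
    (hτ : ∀ v w, τ' (d v) (d w) = τ v w) (v : V) :
    d (polarVia (d.trans e) h τ v) = polarVia e h' τ' (d v) := by
  have e₁ : formVia (d.trans e) h = formVia e h' := by
    ext v w; simp [← hh]
  have e₂ : formVia (d.trans e) τ = formVia e τ' := by
    ext v w; simp [← hτ]
  simp [polarVia, e₁, e₂]

theorem polarVia_eq (e e' : V ≃L[ℝ] E) (h τ : V →L[ℝ] V →L[ℝ] ℝ) :
    polarVia e h τ = polarVia e' h τ := by
  have hc : ∀ B : V →L[ℝ] V →L[ℝ] ℝ, formVia e B = (formVia e' B).bilinearComp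
      ((e.symm.trans e' : E ≃L[ℝ] E) : E →L[ℝ] E) ((e.symm.trans e' : E ≃L[ℝ] E) : E →L[ℝ] E) := by
    intro B; ext v w; simp
  ext v
  rw [polarVia, hc, hc, polarComplex_bilinearComp]
  simp [polarVia]

end FormVia

section Bundle

open Bundle ContinuousLinearMap

variable {E : Type*} [NormedAddCommGroup E] [NormedSpace ℝ E]
  {P : Type*} [TopologicalSpace P] [ChartedSpace E P] [IsManifold 𝓘(ℝ, E) ∞ P]

variable (E) in
/-- The identification of the tangent space at `p` with the model space. -/
noncomputable def tangentModel (p : P) : TangentSpace 𝓘(ℝ, E) p ≃L[ℝ] E :=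
  ContinuousLinearEquiv.refl ℝ E

variable (E) in
/-- The identification of the tangent space at `p` with the model space given by the trivialization
at `p₀`. -/
noncomputable def tangentFrame (p₀ : P) {p : P} (hp : p ∈ (chartAt E p₀).source) :
    TangentSpace 𝓘(ℝ, E) p ≃L[ℝ] E :=
  (trivializationAt E (TangentSpace 𝓘(ℝ, E)) p₀).continuousLinearEquivAt ℝ p
    ((TangentBundle.trivializationAt_baseSet (I := 𝓘(ℝ, E)) p₀).symm ▸ hp)

theorem contMDiffAt_form_iff (B : ∀ p : P, TangentSpace 𝓘(ℝ, E) p →L[ℝ] TangentSpace 𝓘(ℝ, E) p →L[ℝ] ℝ)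
    (p₀ : P) :
    ContMDiffAt 𝓘(ℝ, E) (𝓘(ℝ, E).prod 𝓘(ℝ, E →L[ℝ] E →L[ℝ] ℝ)) ∞
      (fun p ↦ TotalSpace.mk' (E →L[ℝ] E →L[ℝ] ℝ) p (B p)) p₀ ↔
    ContMDiffAt 𝓘(ℝ, E) 𝓘(ℝ, E →L[ℝ] E →L[ℝ] ℝ) ∞
      (fun p ↦ inCoordinates E (TangentSpace 𝓘(ℝ, E)) (E →L[ℝ] ℝ)
        (fun p : P ↦ TangentSpace 𝓘(ℝ, E) p →L[ℝ] ℝ) p₀ p p₀ p (B p)) p₀ := by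
  rw [contMDiffAt_hom_bundle]
  exact and_iff_right contMDiffAt_id

theorem inCoordinates_form (p₀ : P) {p : P} (hp : p ∈ (chartAt E p₀).source)
    (B : TangentSpace 𝓘(ℝ, E) p →L[ℝ] TangentSpace 𝓘(ℝ, E) p →L[ℝ] ℝ) :
    inCoordinates E (TangentSpace 𝓘(ℝ, E)) (E →L[ℝ] ℝ)
        (fun p : P ↦ TangentSpace 𝓘(ℝ, E) p →L[ℝ] ℝ) p₀ p p₀ p B =
      formVia (tangentFrame E p₀ hp) B := by
  have hb : p ∈ (trivializationAt E (TangentSpace 𝓘(ℝ, E)) p₀).baseSet :=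
    (TangentBundle.trivializationAt_baseSet (I := 𝓘(ℝ, E)) p₀).symm ▸ hp
  ext v w
  refine (inCoordinates_apply_eq₂ (F₃ := ℝ) (E₃ := Bundle.Trivial P ℝ) hb hb (by simp)).trans ?_
  rw [formVia_apply]
  simp [tangentFrame]

theorem contMDiffAt_endo_iff (J : ∀ p : P, TangentSpace 𝓘(ℝ, E) p →L[ℝ] TangentSpace 𝓘(ℝ, E) p)
    (p₀ : P) :
    ContMDiffAt 𝓘(ℝ, E) (𝓘(ℝ, E).prod 𝓘(ℝ, E →L[ℝ] E)) ∞
      (fun p ↦ TotalSpace.mk' (E →L[ℝ] E) p (J p)) p₀ ↔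
    ContMDiffAt 𝓘(ℝ, E) 𝓘(ℝ, E →L[ℝ] E) ∞
      (fun p ↦ inCoordinates E (TangentSpace 𝓘(ℝ, E)) E
        (TangentSpace 𝓘(ℝ, E)) p₀ p p₀ p (J p)) p₀ := by
  rw [contMDiffAt_hom_bundle]
  exact and_iff_right contMDiffAt_id

theorem inCoordinates_endo (p₀ : P) {p : P} (hp : p ∈ (chartAt E p₀).source)
    (J : TangentSpace 𝓘(ℝ, E) p →L[ℝ] TangentSpace 𝓘(ℝ, E) p) :
    inCoordinates E (TangentSpace 𝓘(ℝ, E)) E (TangentSpace 𝓘(ℝ, E)) p₀ p p₀ p J =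
      tangentFrame E p₀ hp ∘L J ∘L (tangentFrame E p₀ hp).symm := by
  have hb : p ∈ (trivializationAt E (TangentSpace 𝓘(ℝ, E)) p₀).baseSet :=
    (TangentBundle.trivializationAt_baseSet (I := 𝓘(ℝ, E)) p₀).symm ▸ hp
  rw [inCoordinates_eq hb hb]
  rfl

end Bundle

section Average

open MeasureTheory Set Filter Topology Bundle

variable {EG : Type*} [NormedAddCommGroup EG] [NormedSpace ℝ EG]
  {G : Type*} [TopologicalSpace G] [ChartedSpace EG G] [Group G]
  {E : Type*} [NormedAddCommGroup E] [NormedSpace ℝ E]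
  {P : Type*} [TopologicalSpace P] [ChartedSpace E P] [MulAction G P]

theorem exists_pos_symm_form (E : Type*) [NormedAddCommGroup E] [NormedSpace ℝ E]
    [FiniteDimensional ℝ E] :
    ∃ b : E →L[ℝ] E →L[ℝ] ℝ, (∀ v w, b v w = b w v) ∧ ∀ v, v ≠ 0 → 0 < b v v := by
  let T : E →L[ℝ] EuclideanSpace ℝ (Fin (Module.finrank ℝ E)) :=
    (toEuclidean : E ≃L[ℝ] EuclideanSpace ℝ (Fin (Module.finrank ℝ E)))
  refine ⟨(innerSL ℝ).bilinearComp T T, fun v w ↦ ?_, fun v hv ↦ ?_⟩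
  · exact real_inner_comm (T w) (T v)
  · exact (real_inner_self_pos (x := T v)).2 ((toEuclidean (E := E)).map_ne_zero_iff.2 hv)

theorem contDiff_bilinearComp_self (b : E →L[ℝ] E →L[ℝ] ℝ) :
    ContDiff ℝ ∞ (fun D : E →L[ℝ] E ↦ b.bilinearComp D D) := by
  have hf : ContDiff ℝ ∞ (ContinuousLinearMap.flip : (E →L[ℝ] E →L[ℝ] ℝ) → E →L[ℝ] E →L[ℝ] ℝ) := by
    rw [← ContinuousLinearMap.coe_flipₗᵢ]
    exact LinearIsometryEquiv.contDiff _
  exact hf.comp ((hf.comp (contDiff_const.clm_comp contDiff_id)).clm_comp contDiff_id)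

/-- The pullback of the form `b` under the derivative of `x ↦ u (g⁻¹ • x)`, in the chart at `p₀`. -/
noncomputable def chartPullback (b : E →L[ℝ] E →L[ℝ] ℝ) (u : P → E) (p₀ : P) (x : E) (g : G) :
    E →L[ℝ] E →L[ℝ] ℝ :=
  b.bilinearComp (fderiv ℝ (fun y ↦ u (g⁻¹ • (extChartAt 𝓘(ℝ, E) p₀).symm y)) x)
    (fderiv ℝ (fun y ↦ u (g⁻¹ • (extChartAt 𝓘(ℝ, E) p₀).symm y)) x)

theorem chartPullback_local [LieGroup 𝓘(ℝ, EG) ∞ G] [IsManifold 𝓘(ℝ, E) ∞ P]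
    [ContMDiffSMul 𝓘(ℝ, EG) 𝓘(ℝ, E) ∞ G P] (b : E →L[ℝ] E →L[ℝ] ℝ) {u : P → E}
    (hu : ContMDiff 𝓘(ℝ, E) 𝓘(ℝ, E) ∞ u) (p₀ : P) {x : E}
    (hx : x ∈ (extChartAt 𝓘(ℝ, E) p₀).target) (g₀ : G) :
    ∃ (c : G → EG) (Ψ : E × EG → E →L[ℝ] E →L[ℝ] ℝ), ContinuousAt c g₀ ∧
      ContDiffAt ℝ ∞ Ψ (x, c g₀) ∧
      ∀ᶠ q : E × G in 𝓝 (x, g₀), chartPullback b u p₀ q.1 q.2 = Ψ (q.1, c q.2) := by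
  set c := extChartAt 𝓘(ℝ, EG) g₀ with hc
  set χ := extChartAt 𝓘(ℝ, E) p₀ with hχ
  let w : E × EG → E := fun q ↦ u ((c.symm q.2)⁻¹ • χ.symm q.1)
  have hw : ContDiffAt ℝ ∞ w (x, c g₀) := by
    rw [← contMDiffAt_iff_contDiffAt]
    have h₁ : ContMDiffAt 𝓘(ℝ, E × EG) 𝓘(ℝ, E) ∞ (fun q : E × EG ↦ χ.symm q.1) (x, c g₀) :=
      ContMDiffAt.comp (f := Prod.fst) (x, c g₀)
        ((contMDiffOn_extChartAt_symm p₀).contMDiffAt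
          ((isOpen_extChartAt_target p₀).mem_nhds hx)) contDiffAt_fst.contMDiffAt
    have h₂ : ContMDiffAt 𝓘(ℝ, E × EG) 𝓘(ℝ, EG) ∞ (fun q : E × EG ↦ c.symm q.2) (x, c g₀) :=
      ContMDiffAt.comp (f := Prod.snd) (x, c g₀)
        ((contMDiffOn_extChartAt_symm g₀).contMDiffAt
          ((isOpen_extChartAt_target g₀).mem_nhds (mem_extChartAt_target g₀)))
        contDiffAt_snd.contMDiffAt
    exact hu.contMDiffAt.comp _ ((ContMDiffSMul.contMDiff_smul (I := 𝓘(ℝ, EG)) (I' := 𝓘(ℝ, E))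
      (n := ∞)).contMDiffAt.comp _ (h₂.inv.prodMk h₁))
  have hcc : ContinuousAt c g₀ := continuousAt_extChartAt g₀
  refine ⟨c, fun q ↦ b.bilinearComp (fderiv ℝ w q ∘L ContinuousLinearMap.inl ℝ E EG)
    (fderiv ℝ w q ∘L ContinuousLinearMap.inl ℝ E EG), hcc, ?_, ?_⟩
  · refine (contDiff_bilinearComp_self b).contDiffAt.comp (x, c g₀) ?_
    exact (hw.fderiv_right (m := ∞) (by simp)).clm_comp contDiffAt_const
  · have hpair : ContinuousAt (fun q : E × G ↦ (q.1, c q.2)) (x, g₀) :=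
      continuousAt_fst.prodMk (ContinuousAt.comp (f := Prod.snd) (x := (x, g₀)) hcc continuousAt_snd)
    have hd := hpair.eventually ((hw.of_le (m := 1) (by simp)).eventually (by simp))
    have hs : ∀ᶠ q : E × G in 𝓝 (x, g₀), q.2 ∈ c.source :=
      continuousAt_snd.eventually (extChartAt_source_mem_nhds g₀)
    filter_upwards [hd, hs] with q hq hqs
    have hD : fderiv ℝ (fun y ↦ u (q.2⁻¹ • χ.symm y)) q.1 =
        fderiv ℝ w (q.1, c q.2) ∘L ContinuousLinearMap.inl ℝ E EG := by
      have h₁ : HasFDerivAt (fun y : E ↦ (y, c q.2)) (ContinuousLinearMap.inl ℝ E EG) q.1 :=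
        hasFDerivAt_prodMk_left _ _
      have h₂ := (hq.differentiableAt one_ne_zero).hasFDerivAt.comp q.1 h₁
      rw [← h₂.fderiv]
      congr 1
      ext y
      simp [w, c.left_inv hqs]
    simp only [chartPullback, ← hχ, hD]

/-- The derivative at `p` of `x ↦ u (g⁻¹ • x)`. -/
noncomputable def orbitDeriv (u : P → E) (g : G) (p : P) : TangentSpace 𝓘(ℝ, E) p →L[ℝ] E :=
  mvfderiv 𝓘(ℝ, E) (fun q ↦ u (g⁻¹ • q)) p

theorem orbitDeriv_tangentFrame [LieGroup 𝓘(ℝ, EG) ∞ G] [IsManifold 𝓘(ℝ, E) ∞ P]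
    [ContMDiffSMul 𝓘(ℝ, EG) 𝓘(ℝ, E) ∞ G P] {u : P → E}
    (hu : ContMDiff 𝓘(ℝ, E) 𝓘(ℝ, E) ∞ u) (g : G) (p₀ : P) {p : P}
    (hp : p ∈ (chartAt E p₀).source) :
    orbitDeriv u g p ∘L (tangentFrame E p₀ hp).symm =
      fderiv ℝ (fun y ↦ u (g⁻¹ • (extChartAt 𝓘(ℝ, E) p₀).symm y)) (extChartAt 𝓘(ℝ, E) p₀ p) := by
  set χ := extChartAt 𝓘(ℝ, E) p₀ with hχ
  have hps : p ∈ χ.source := by rwa [hχ, extChartAt_source]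
  have hf : ContMDiff 𝓘(ℝ, E) 𝓘(ℝ, E) ∞ (fun q : P ↦ u (g⁻¹ • q)) :=
    hu.comp (ContMDiffSMul.contMDiff_const_smul (I := 𝓘(ℝ, EG)) g⁻¹)
  have hk : ContMDiffAt 𝓘(ℝ, E) 𝓘(ℝ, E) ∞ (fun y ↦ u (g⁻¹ • χ.symm y)) (χ p) :=
    hf.contMDiffAt.comp _ ((contMDiffOn_extChartAt_symm p₀).contMDiffAt
          ((isOpen_extChartAt_target p₀).mem_nhds (χ.map_source hps)))
  have heq : (fun q : P ↦ u (g⁻¹ • q)) =ᶠ[𝓝 p] (fun y ↦ u (g⁻¹ • χ.symm y)) ∘ χ := by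
    filter_upwards [(isOpen_extChartAt_source p₀).mem_nhds hps] with q hq
    simp [χ.left_inv hq]
  have hm : MDifferentiableAt 𝓘(ℝ, E) 𝓘(ℝ, E) χ p := mdifferentiableAt_extChartAt hp
  have hfr : ∀ v, mfderiv 𝓘(ℝ, E) 𝓘(ℝ, E) χ p v = tangentFrame E p₀ hp v := fun v ↦ by
    have h := DFunLike.congr_fun (TangentBundle.continuousLinearMapAt_trivializationAt
      (I := 𝓘(ℝ, E)) hp) v
    rw [← Bundle.Trivialization.coe_continuousLinearEquivAt_eq _
      ((TangentBundle.trivializationAt_baseSet (I := 𝓘(ℝ, E)) p₀).symm ▸ hp)] at h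
    exact h.symm
  ext v
  have h₁ : orbitDeriv u g p ((tangentFrame E p₀ hp).symm v) =
      mfderiv 𝓘(ℝ, E) 𝓘(ℝ, E) (fun q : P ↦ u (g⁻¹ • q)) p ((tangentFrame E p₀ hp).symm v) := rfl
  have h₂ := mfderiv_comp p (hk.mdifferentiableAt (by simp)) hm
  rw [ContinuousLinearMap.comp_apply, ContinuousLinearEquiv.coe_coe, h₁, heq.mfderiv_eq, h₂,
    ← mfderiv_eq_fderiv]
  refine Eq.trans (congrArg (mfderiv 𝓘(ℝ, E) 𝓘(ℝ, E) (fun y ↦ u (g⁻¹ • χ.symm y)) (χ p))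
    (hfr ((tangentFrame E p₀ hp).symm v))) ?_
  rw [ContinuousLinearEquiv.apply_symm_apply]
  rfl

end Average

section AvgForm

set_option synthInstance.maxHeartbeats 400000

open MeasureTheory Set Filter Topology Bundle

variable {EG : Type*} [NormedAddCommGroup EG] [NormedSpace ℝ EG]
  {G : Type*} [TopologicalSpace G] [ChartedSpace EG G] [Group G]
  {E : Type*} [NormedAddCommGroup E] [NormedSpace ℝ E]
  {P : Type*} [TopologicalSpace P] [ChartedSpace E P] [MulAction G P]

theorem integral_clm_apply_of_hasCompactSupport {F : Type*} [NormedAddCommGroup F]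
    [NormedSpace ℝ F] {X : Type*} [TopologicalSpace X] [MeasurableSpace X] [OpensMeasurableSpace X]
    {μ : Measure X} [IsFiniteMeasureOnCompacts μ] {f : X → E →L[ℝ] F} (hf : Continuous f)
    (hc : HasCompactSupport f) (v : E) : (∫ x, f x ∂μ) v = ∫ x, f x v ∂μ :=
  ContinuousLinearMap.integral_apply (hf.integrable_of_hasCompactSupport hc) v

theorem integral_bilin_apply {X : Type*} [TopologicalSpace X] [MeasurableSpace X]
    [OpensMeasurableSpace X] {μ : Measure X} [IsFiniteMeasureOnCompacts μ]
    {f : X → E →L[ℝ] E →L[ℝ] ℝ} (hf : Continuous f) (hc : HasCompactSupport f) (v w : E) :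
    (∫ x, f x ∂μ) v w = ∫ x, f x v w ∂μ := by
  rw [integral_clm_apply_of_hasCompactSupport hf hc, integral_clm_apply_of_hasCompactSupport
    (hf.clm_apply continuous_const)
    (hc.comp_left (g := fun B : E →L[ℝ] E →L[ℝ] ℝ ↦ B v) (by simp))]

theorem exists_isCompact_chartPullback_eq_zero [IsTopologicalGroup G] [FiniteDimensional ℝ E]
    [ProperSMul G P]
    (b : E →L[ℝ] E →L[ℝ] ℝ) {u : P → E} (hu : HasCompactSupport u) (p₀ : P) :
    ∃ K : Set G, IsCompact K ∧ IsClosed K ∧ ∃ U : Set E, IsOpen U ∧ extChartAt 𝓘(ℝ, E) p₀ p₀ ∈ U ∧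
      U ⊆ (extChartAt 𝓘(ℝ, E) p₀).target ∧ ∀ x ∈ U, ∀ g ∉ K, chartPullback b u p₀ x g = 0 := by
  have : LocallyCompactSpace P := Manifold.locallyCompact_of_finiteDimensional 𝓘(ℝ, E)
  obtain ⟨L, hL, hpL⟩ := exists_compact_mem_nhds p₀
  have hK := ProperSMul.isCompact_setOfPred_inter_nonempty (G := G) hu hL
  refine ⟨_, hK.closure, isClosed_closure,
    (extChartAt 𝓘(ℝ, E) p₀).target ∩ (extChartAt 𝓘(ℝ, E) p₀).symm ⁻¹' interior L,
    (continuousOn_extChartAt_symm p₀).isOpen_inter_preimage (isOpen_extChartAt_target p₀)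
      isOpen_interior, ⟨mem_extChartAt_target p₀, ?_⟩, inter_subset_left, fun x hx g hg ↦ ?_⟩
  · simpa using mem_interior_iff_mem_nhds.2 hpL
  · have hU := ((continuousOn_extChartAt_symm (I := 𝓘(ℝ, E)) p₀).isOpen_inter_preimage
      (isOpen_extChartAt_target p₀) (isOpen_interior (s := L))).mem_nhds hx
    have h0 : (fun y ↦ u (g⁻¹ • (extChartAt 𝓘(ℝ, E) p₀).symm y)) =ᶠ[𝓝 x] fun _ ↦ 0 := by
      filter_upwards [hU] with y hy
      by_contra hne
      refine hg (subset_closure ⟨(extChartAt 𝓘(ℝ, E) p₀).symm y,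
        ⟨_, subset_tsupport _ hne, ?_⟩, interior_subset hy.2⟩)
      simp
    ext v w
    rw [chartPullback, h0.fderiv_eq]
    simp

/-- The pullback of `b` under `orbitDeriv u g p`, read in the model space through `e`. -/
noncomputable def pullbackVia (b : E →L[ℝ] E →L[ℝ] ℝ) (u : P → E) (p : P)
    (e : TangentSpace 𝓘(ℝ, E) p ≃L[ℝ] E) (g : G) : E →L[ℝ] E →L[ℝ] ℝ :=
  b.bilinearComp (orbitDeriv u g p ∘L e.symm) (orbitDeriv u g p ∘L e.symm)

/-- The average over `G` of the pullbacks of `b` under the maps `x ↦ u (g⁻¹ • x)`. -/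
noncomputable def avgForm [MeasurableSpace G] (μ : Measure G) (b : E →L[ℝ] E →L[ℝ] ℝ) (u : P → E) (p : P) :
    TangentSpace 𝓘(ℝ, E) p →L[ℝ] TangentSpace 𝓘(ℝ, E) p →L[ℝ] ℝ :=
  (formVia (tangentModel E p)).symm (∫ g, pullbackVia b u p (tangentModel E p) g ∂μ)

theorem formVia_avgForm [MeasurableSpace G] (μ : Measure G) (b : E →L[ℝ] E →L[ℝ] ℝ) (u : P → E) (p : P)
    (e : TangentSpace 𝓘(ℝ, E) p ≃L[ℝ] E) :
    formVia e (avgForm μ b u p) = ∫ g, pullbackVia b u p e g ∂μ := by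
  have h := ContinuousLinearEquiv.integral_comp_comm (𝕜 := ℝ) (μ := μ)
    (E := E →L[ℝ] E →L[ℝ] ℝ) (F := E →L[ℝ] E →L[ℝ] ℝ)
    ((formVia (tangentModel E p)).symm.trans (formVia e)) (pullbackVia b u p (tangentModel E p))
  rw [avgForm]
  refine h.symm.trans (integral_congr_ae (.of_forall fun g ↦ ?_))
  ext v w
  have hs : ∀ B : E →L[ℝ] E →L[ℝ] ℝ, ∀ v w, (formVia (tangentModel E p)).symm B v w =
      B (tangentModel E p v) (tangentModel E p w) := fun B v w ↦ by
    have := formVia_apply (tangentModel E p) ((formVia (tangentModel E p)).symm B)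
      (tangentModel E p v) (tangentModel E p w)
    simpa using this.symm
  simp [pullbackVia, hs]

theorem pullbackVia_tangentFrame [LieGroup 𝓘(ℝ, EG) ∞ G] [IsManifold 𝓘(ℝ, E) ∞ P]
    [ContMDiffSMul 𝓘(ℝ, EG) 𝓘(ℝ, E) ∞ G P] (b : E →L[ℝ] E →L[ℝ] ℝ) {u : P → E}
    (hu : ContMDiff 𝓘(ℝ, E) 𝓘(ℝ, E) ∞ u) (p₀ : P) {p : P} (hp : p ∈ (chartAt E p₀).source) (g : G) :
    pullbackVia b u p (tangentFrame E p₀ hp) g =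
      chartPullback b u p₀ (extChartAt 𝓘(ℝ, E) p₀ p) g := by
  rw [pullbackVia, orbitDeriv_tangentFrame (EG := EG) hu, chartPullback]

variable [FiniteDimensional ℝ E] [ProperSMul G P]

theorem contMDiff_avgForm [LieGroup 𝓘(ℝ, EG) ∞ G] [IsManifold 𝓘(ℝ, E) ∞ P]
    [ContMDiffSMul 𝓘(ℝ, EG) 𝓘(ℝ, E) ∞ G P] [MeasurableSpace G] [BorelSpace G]
    (μ : Measure G) [μ.IsHaarMeasure] (b : E →L[ℝ] E →L[ℝ] ℝ) {u : P → E}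
    (hu : ContMDiff 𝓘(ℝ, E) 𝓘(ℝ, E) ∞ u) (hc : HasCompactSupport u) :
    ContMDiff 𝓘(ℝ, E) (𝓘(ℝ, E).prod 𝓘(ℝ, E →L[ℝ] E →L[ℝ] ℝ)) ∞
      (fun p ↦ TotalSpace.mk' (E →L[ℝ] E →L[ℝ] ℝ) p (avgForm μ b u p)) := by
  intro p₀
  have : IsTopologicalGroup G := topologicalGroup_of_lieGroup 𝓘(ℝ, EG) ∞
  obtain ⟨K, hK, hKc, U, hU, hpU, hUt, h0⟩ :=
    exists_isCompact_chartPullback_eq_zero (G := G) b hc p₀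
  have hsm := contDiffOn_setIntegral (μ := μ) hK hKc.measurableSet hU
    (f := chartPullback b u p₀) (W := EG) fun x hx g _ ↦ chartPullback_local b hu p₀ (hUt hx) g
  rw [contMDiffAt_form_iff]
  have hχ : ContMDiffAt 𝓘(ℝ, E) 𝓘(ℝ, E) ∞ (extChartAt 𝓘(ℝ, E) p₀) p₀ := contMDiffAt_extChartAt
  have h₁ := ((hsm.contDiffAt (hU.mem_nhds hpU)).contMDiffAt).comp p₀ hχ
  refine h₁.congr_of_eventuallyEq ?_
  filter_upwards [(continuousAt_extChartAt (I := 𝓘(ℝ, E)) p₀).preimage_mem_nhds (hU.mem_nhds hpU),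
    (chartAt E p₀).open_source.mem_nhds (mem_chart_source E p₀)] with p hpU' hp
  rw [inCoordinates_form p₀ hp, formVia_avgForm]
  simp only [pullbackVia_tangentFrame (EG := EG) b hu, Function.comp_apply]
  exact (setIntegral_eq_integral_of_forall_compl_eq_zero fun g hg ↦ h0 _ hpU' g hg).symm

theorem continuous_chartPullback [LieGroup 𝓘(ℝ, EG) ∞ G] [IsManifold 𝓘(ℝ, E) ∞ P]
    [ContMDiffSMul 𝓘(ℝ, EG) 𝓘(ℝ, E) ∞ G P] (b : E →L[ℝ] E →L[ℝ] ℝ) {u : P → E}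
    (hu : ContMDiff 𝓘(ℝ, E) 𝓘(ℝ, E) ∞ u) (p : P) :
    Continuous (fun g : G ↦ chartPullback b u p (extChartAt 𝓘(ℝ, E) p p) g) := by
  refine continuous_iff_continuousAt.2 fun g ↦ ?_
  obtain ⟨c, Ψ, hc, hΨ, h⟩ := chartPullback_local (EG := EG) b hu p (mem_extChartAt_target p) g
  have h₁ : ContinuousAt (fun a ↦ Ψ (extChartAt 𝓘(ℝ, E) p p, c a)) g :=
    ContinuousAt.comp (f := fun a ↦ (extChartAt 𝓘(ℝ, E) p p, c a)) hΨ.continuousAt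
      (continuousAt_const.prodMk hc)
  exact h₁.congr (((by fun_prop : Continuous fun a : G ↦
    (extChartAt 𝓘(ℝ, E) p p, a)).continuousAt.eventually h).mono fun _ h ↦ h.symm)

theorem hasCompactSupport_chartPullback [IsTopologicalGroup G] (b : E →L[ℝ] E →L[ℝ] ℝ) {u : P → E}
    (hc : HasCompactSupport u) (p : P) :
    HasCompactSupport (fun g : G ↦ chartPullback b u p (extChartAt 𝓘(ℝ, E) p p) g) := by
  obtain ⟨K, hK, -, U, -, hpU, -, h0⟩ :=
    exists_isCompact_chartPullback_eq_zero (G := G) b hc p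
  exact HasCompactSupport.intro hK fun g hg ↦ h0 _ hpU g hg

theorem chartPullback_tangentFrame_apply [LieGroup 𝓘(ℝ, EG) ∞ G] [IsManifold 𝓘(ℝ, E) ∞ P]
    [ContMDiffSMul 𝓘(ℝ, EG) 𝓘(ℝ, E) ∞ G P] (b : E →L[ℝ] E →L[ℝ] ℝ) {u : P → E}
    (hu : ContMDiff 𝓘(ℝ, E) 𝓘(ℝ, E) ∞ u) (p : P) (v w : TangentSpace 𝓘(ℝ, E) p) (g : G) :
    chartPullback b u p (extChartAt 𝓘(ℝ, E) p p) g
      (tangentFrame E p (mem_chart_source E p) v) (tangentFrame E p (mem_chart_source E p) w) =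
      b (orbitDeriv u g p v) (orbitDeriv u g p w) := by
  rw [← pullbackVia_tangentFrame (EG := EG) b hu p (mem_chart_source E p)]
  simp [pullbackVia]

theorem avgForm_apply [LieGroup 𝓘(ℝ, EG) ∞ G] [IsManifold 𝓘(ℝ, E) ∞ P]
    [ContMDiffSMul 𝓘(ℝ, EG) 𝓘(ℝ, E) ∞ G P] [MeasurableSpace G] [BorelSpace G]
    (μ : Measure G) [μ.IsHaarMeasure] (b : E →L[ℝ] E →L[ℝ] ℝ) {u : P → E}
    (hu : ContMDiff 𝓘(ℝ, E) 𝓘(ℝ, E) ∞ u) (hc : HasCompactSupport u) (p : P)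
    (v w : TangentSpace 𝓘(ℝ, E) p) :
    avgForm μ b u p v w = ∫ g, b (orbitDeriv u g p v) (orbitDeriv u g p w) ∂μ := by
  have : IsTopologicalGroup G := topologicalGroup_of_lieGroup 𝓘(ℝ, EG) ∞
  set e := tangentFrame E p (mem_chart_source E p) with he
  have h₁ : avgForm μ b u p v w = formVia e (avgForm μ b u p) (e v) (e w) := by simp
  rw [h₁, formVia_avgForm]
  simp only [he, pullbackVia_tangentFrame (EG := EG) b hu]
  rw [integral_bilin_apply (continuous_chartPullback (EG := EG) b hu p)
    (hasCompactSupport_chartPullback b hc p)]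
  simp only [chartPullback_tangentFrame_apply (EG := EG) b hu]

theorem avgForm_pos [LieGroup 𝓘(ℝ, EG) ∞ G] [IsManifold 𝓘(ℝ, E) ∞ P]
    [ContMDiffSMul 𝓘(ℝ, EG) 𝓘(ℝ, E) ∞ G P] [MeasurableSpace G] [BorelSpace G]
    (μ : Measure G) [μ.IsHaarMeasure] (b : E →L[ℝ] E →L[ℝ] ℝ) (hb : ∀ v, v ≠ 0 → 0 < b v v) {u : P → E}
    (hu : ContMDiff 𝓘(ℝ, E) 𝓘(ℝ, E) ∞ u) (hc : HasCompactSupport u) (p : P)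
    (v : TangentSpace 𝓘(ℝ, E) p) (hv : ∃ g : G, orbitDeriv u g p v ≠ 0) :
    0 < avgForm μ b u p v v := by
  have : IsTopologicalGroup G := topologicalGroup_of_lieGroup 𝓘(ℝ, EG) ∞
  obtain ⟨g, hg⟩ := hv
  rw [avgForm_apply (EG := EG) μ b hu hc]
  have heq := chartPullback_tangentFrame_apply (EG := EG) (G := G) b hu p v v
  refine Continuous.integral_pos_of_hasCompactSupport_nonneg_nonzero (x := g) ?_ ?_ (fun g ↦ ?_)
    (hb _ hg).ne'
  · simp only [← heq]
    exact ((continuous_chartPullback (EG := EG) b hu p).clm_apply continuous_const).clm_apply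
      continuous_const
  · simp only [← heq]
    exact (hasCompactSupport_chartPullback b hc p).comp_left
      (g := fun B : E →L[ℝ] E →L[ℝ] ℝ ↦ B (tangentFrame E p (mem_chart_source E p) v)
        (tangentFrame E p (mem_chart_source E p) v)) (by simp)
  · rcases eq_or_ne (orbitDeriv u g p v) 0 with h | h
    · simp [h]
    · exact (hb _ h).le

theorem avgForm_nonneg [LieGroup 𝓘(ℝ, EG) ∞ G] [IsManifold 𝓘(ℝ, E) ∞ P]
    [ContMDiffSMul 𝓘(ℝ, EG) 𝓘(ℝ, E) ∞ G P] [MeasurableSpace G] [BorelSpace G]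
    (μ : Measure G) [μ.IsHaarMeasure] (b : E →L[ℝ] E →L[ℝ] ℝ) (hb : ∀ v, v ≠ 0 → 0 < b v v) {u : P → E}
    (hu : ContMDiff 𝓘(ℝ, E) 𝓘(ℝ, E) ∞ u) (hc : HasCompactSupport u) (p : P)
    (v : TangentSpace 𝓘(ℝ, E) p) : 0 ≤ avgForm μ b u p v v := by
  rw [avgForm_apply (EG := EG) μ b hu hc]
  refine integral_nonneg fun g ↦ ?_
  rcases eq_or_ne (orbitDeriv u g p v) 0 with h | h
  · simp [h]
  · exact (hb _ h).le

theorem orbitDeriv_smul [LieGroup 𝓘(ℝ, EG) ∞ G] [IsManifold 𝓘(ℝ, E) ∞ P]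
    [ContMDiffSMul 𝓘(ℝ, EG) 𝓘(ℝ, E) ∞ G P] {u : P → E} (hu : ContMDiff 𝓘(ℝ, E) 𝓘(ℝ, E) ∞ u) (a g : G) (p : P)
    (v : TangentSpace 𝓘(ℝ, E) p) :
    orbitDeriv u g (a • p) (mfderiv 𝓘(ℝ, E) 𝓘(ℝ, E) (fun q : P ↦ a • q) p v) =
      orbitDeriv u (a⁻¹ * g) p v := by
  have hf : ContMDiff 𝓘(ℝ, E) 𝓘(ℝ, E) ∞ (fun q : P ↦ u (g⁻¹ • q)) :=
    hu.comp (ContMDiffSMul.contMDiff_const_smul (I := 𝓘(ℝ, EG)) g⁻¹)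
  have ha : ContMDiff 𝓘(ℝ, E) 𝓘(ℝ, E) ∞ (fun q : P ↦ a • q) := ContMDiffSMul.contMDiff_const_smul (I := 𝓘(ℝ, EG)) a
  have h := mfderiv_comp_apply (x := p) (hf.mdifferentiableAt (by simp) (x := a • p))
    (ha.mdifferentiableAt (by simp) (x := p)) v
  have he : (fun q : P ↦ u ((a⁻¹ * g)⁻¹ • q)) = (fun q : P ↦ u (g⁻¹ • q)) ∘ fun q : P ↦ a • q := by
    ext q
    simp [mul_smul]
  rw [orbitDeriv, orbitDeriv, he]
  exact h.symm

theorem avgForm_smul [LieGroup 𝓘(ℝ, EG) ∞ G] [IsManifold 𝓘(ℝ, E) ∞ P]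
    [ContMDiffSMul 𝓘(ℝ, EG) 𝓘(ℝ, E) ∞ G P] [MeasurableSpace G] [BorelSpace G]
    (μ : Measure G) [μ.IsHaarMeasure] (b : E →L[ℝ] E →L[ℝ] ℝ) {u : P → E}
    (hu : ContMDiff 𝓘(ℝ, E) 𝓘(ℝ, E) ∞ u) (hc : HasCompactSupport u) (a : G) (p : P)
    (v w : TangentSpace 𝓘(ℝ, E) p) :
    avgForm μ b u (a • p) (mfderiv 𝓘(ℝ, E) 𝓘(ℝ, E) (fun q : P ↦ a • q) p v)
      (mfderiv 𝓘(ℝ, E) 𝓘(ℝ, E) (fun q : P ↦ a • q) p w) = avgForm μ b u p v w := by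
  have : IsTopologicalGroup G := topologicalGroup_of_lieGroup 𝓘(ℝ, EG) ∞
  rw [avgForm_apply (EG := EG) μ b hu hc, avgForm_apply (EG := EG) μ b hu hc]
  simp only [orbitDeriv_smul (EG := EG) hu]
  exact integral_mul_left_eq_self (fun g ↦ b (orbitDeriv u g p v) (orbitDeriv u g p w)) a⁻¹

theorem orbitDeriv_eq_zero {u : P → E} {g : G} {p : P} (h : g⁻¹ • p ∉ tsupport u) :
    orbitDeriv u g p = 0 := by
  have h0 : (fun q : P ↦ u (g⁻¹ • q)) =ᶠ[𝓝 p] fun _ ↦ 0 :=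
    (continuous_const_smul g⁻¹).continuousAt.eventually
      (notMem_tsupport_iff_eventuallyEq.1 h)
  ext v
  rw [orbitDeriv, mvfderiv, h0.mfderiv_eq, mfderiv_const]
  rfl

end AvgForm

section OrbitCover

open Set Filter Topology Pointwise

universe u

variable {X : Type u} [TopologicalSpace X]

/-- A connected component of a paracompact locally compact, locally connected space has an
exhaustion by compact sets. -/
theorem exists_exhaustion_connectedComponent [T2Space X] [LocallyCompactSpace X]
    [LocallyConnectedSpace X] [ParacompactSpace X] (x : X) :
    ∃ B : ℕ → Set X, (∀ n, IsCompact (B n)) ∧ (∀ n, B n ⊆ interior (B (n + 1))) ∧ B 0 = ∅ ∧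
      B 1 = ∅ ∧ ⋃ n, B n = connectedComponent x := by
  choose L hL hxL using fun y : X ↦ exists_compact_mem_nhds y
  obtain ⟨V, hVo, hVc, hVf, hVL⟩ := precise_refinement (fun y ↦ interior (L y))
    (fun _ ↦ isOpen_interior) (iUnion_eq_univ_iff.2 fun y ↦ ⟨y, mem_interior_iff_mem_nhds.2 (hxL y)⟩)
  have hcl : ∀ i, IsCompact (closure (V i)) := fun i ↦
    (hL i).of_isClosed_subset isClosed_closure
      (closure_minimal ((hVL i).trans interior_subset) (hL i).isClosed)
  let A : ℕ → Set X := fun n ↦ n.rec {x} fun _ S ↦ ⋃ i ∈ {i | (V i ∩ S).Nonempty}, closure (V i)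
  have hA : ∀ n, A (n + 1) = ⋃ i ∈ {i | (V i ∩ A n).Nonempty}, closure (V i) := fun n ↦ rfl
  have hAc : ∀ n, IsCompact (A n) := fun n ↦ by
    induction n with
    | zero => exact isCompact_singleton
    | succ n ih =>
      rw [hA]
      exact (hVf.finite_nonempty_inter_compact ih).isCompact_biUnion fun i _ ↦ hcl i
  have hVA : ∀ {i n y}, y ∈ V i → y ∈ A n → V i ⊆ A (n + 1) := fun {i n y} hi hy ↦ by
    rw [hA]
    exact subset_closure.trans (subset_biUnion_of_mem (u := fun i ↦ closure (V i))
      (show i ∈ {i | (V i ∩ A n).Nonempty} from ⟨y, hi, hy⟩))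
  have hAi : ∀ n, A n ⊆ interior (A (n + 1)) := fun n y hy ↦ by
    obtain ⟨i, hi⟩ := iUnion_eq_univ_iff.1 hVc y
    exact mem_interior.2 ⟨V i, hVA hi hy, hVo i, hi⟩
  have hclopen : IsClopen (⋃ n, A n) := by
    constructor
    · rw [← isOpen_compl_iff, isOpen_iff_forall_mem_open]
      intro y hy
      obtain ⟨i, hi⟩ := iUnion_eq_univ_iff.1 hVc y
      refine ⟨V i, fun z hz hzA ↦ hy ?_, hVo i, hi⟩
      obtain ⟨n, hn⟩ := mem_iUnion.1 hzA
      exact mem_iUnion.2 ⟨n + 1, hVA hz hn hi⟩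
    · rw [isOpen_iff_forall_mem_open]
      intro y hy
      obtain ⟨n, hn⟩ := mem_iUnion.1 hy
      exact ⟨interior (A (n + 1)), interior_subset.trans (subset_iUnion A (n + 1)), isOpen_interior,
        hAi n hn⟩
  have hsub : connectedComponent x ⊆ ⋃ n, A n :=
    hclopen.connectedComponent_subset (mem_iUnion.2 ⟨0, rfl⟩)
  let B : ℕ → Set X := fun n ↦ match n with
    | 0 => ∅
    | 1 => ∅
    | n + 2 => A n ∩ connectedComponent x
  refine ⟨B, fun n ↦ ?_, fun n ↦ ?_, rfl, rfl, Subset.antisymm (iUnion_subset fun n ↦ ?_) fun y hy ↦ ?_⟩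
  · match n with
    | 0 => exact isCompact_empty
    | 1 => exact isCompact_empty
    | n + 2 => exact (hAc n).inter_right isClosed_connectedComponent
  · match n with
    | 0 => exact empty_subset _
    | 1 => exact empty_subset _
    | n + 2 =>
      change A n ∩ _ ⊆ interior (A (n + 1) ∩ _)
      rw [interior_inter, isOpen_connectedComponent.interior_eq]
      exact inter_subset_inter_left _ (hAi n)
  · match n with
    | 0 => exact empty_subset _
    | 1 => exact empty_subset _
    | n + 2 => exact inter_subset_right
  · obtain ⟨n, hn⟩ := mem_iUnion.1 (hsub hy)
    exact mem_iUnion.2 ⟨n + 2, hn, hy⟩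

variable {G : Type*} [Group G] [MulAction G X]

variable (G) in
/-- The saturation of a set under a group action. -/
def orbitSaturation (S : Set X) : Set X := {x | ∃ g : G, g • x ∈ S}

theorem smul_mem_orbitSaturation {S : Set X} {x : X} {g : G} :
    g • x ∈ orbitSaturation G S ↔ x ∈ orbitSaturation G S := by
  constructor
  · rintro ⟨a, ha⟩
    exact ⟨a * g, by rwa [mul_smul]⟩
  · rintro ⟨a, ha⟩
    exact ⟨a * g⁻¹, by rwa [mul_smul, inv_smul_smul]⟩

theorem orbitSaturation_mono {S T : Set X} (h : S ⊆ T) :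
    orbitSaturation G S ⊆ orbitSaturation G T := fun _ ⟨g, hg⟩ ↦ ⟨g, h hg⟩

theorem IsOpen.orbitSaturation [ContinuousConstSMul G X] {S : Set X} (hS : IsOpen S) :
    IsOpen (orbitSaturation G S) := by
  have : _root_.orbitSaturation G S = ⋃ g : G, (g • ·) ⁻¹' S := by
    ext x; simp [_root_.orbitSaturation]
  rw [this]
  exact isOpen_iUnion fun g ↦ hS.preimage (continuous_const_smul g)

theorem IsCompact.isClosed_orbitSaturation [TopologicalSpace G] [ProperSMul G X] {S : Set X} (hS : IsCompact S) :
    IsClosed (orbitSaturation G S) := by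
  have : orbitSaturation G S = (univ : Set G) • S := by
    ext x
    constructor
    · rintro ⟨g, hg⟩
      exact ⟨g⁻¹, mem_univ _, g • x, hg, inv_smul_smul _ _⟩
    · rintro ⟨g, -, y, hy, rfl⟩
      exact ⟨g⁻¹, by simpa using hy⟩
  rw [this]
  exact isClosed_univ.smul_right_of_isCompact hS

theorem connectedComponent_smul_congr [ContinuousConstSMul G X] {x y : X} (g : G)
    (h : connectedComponent x = connectedComponent y) :
    connectedComponent (g • x) = connectedComponent (g • y) :=
  connectedComponent_eq ((continuous_const_smul g).mapsTo_connectedComponent x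
    (h ▸ mem_connectedComponent))

variable (X G) in
/-- The equivalence relation whose classes are the saturations of the connected components. -/
def componentOrbitSetoid [ContinuousConstSMul G X] : Setoid X where
  r x y := ∃ g : G, connectedComponent (g • x) = connectedComponent y
  iseqv := by
    refine ⟨fun x ↦ ⟨1, by rw [one_smul]⟩, fun {x y} ⟨g, hg⟩ ↦ ⟨g⁻¹, ?_⟩,
      fun {x y z} ⟨g, hg⟩ ⟨k, hk⟩ ↦ ⟨k * g, ?_⟩⟩
    · rw [← connectedComponent_smul_congr g⁻¹ hg, inv_smul_smul]
    · rw [mul_smul, connectedComponent_smul_congr k hg, hk]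

theorem exists_locallyFinite_orbit_cover [T2Space X] [LocallyCompactSpace X]
    [LocallyConnectedSpace X] [ParacompactSpace X] [TopologicalSpace G] [ProperSMul G X] :
    ∃ (ι : Type u) (K W : ι → Set X), (∀ i, IsCompact (K i)) ∧ (∀ i, IsOpen (W i)) ∧
      (∀ i, K i ⊆ W i) ∧ (∀ x, ∃ (i : ι) (g : G), g • x ∈ K i) ∧
      LocallyFinite fun i ↦ orbitSaturation G (W i) := by
  choose B hBc hBi hB0 hB1 hBU using fun x : X ↦ exists_exhaustion_connectedComponent x
  let Q := Quotient (componentOrbitSetoid X G)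
  have hmono : ∀ x {m n}, m ≤ n → B x m ⊆ B x n := fun x m n h ↦
    monotone_nat_of_le_succ (fun n ↦ (hBi x n).trans interior_subset) h
  have hout : ∀ x : X, ∃ g : G, g • x ∈ connectedComponent (Quotient.out (⟦x⟧ : Q)) := fun x ↦ by
    obtain ⟨g, hg⟩ := (componentOrbitSetoid X G).symm (Quotient.mk_out x)
    exact ⟨g, hg ▸ mem_connectedComponent⟩
  refine ⟨Q × ℕ, fun i ↦ B i.1.out (i.2 + 2) \ orbitSaturation G (interior (B i.1.out (i.2 + 1))),
    fun i ↦ connectedComponent i.1.out \ orbitSaturation G (B i.1.out i.2), fun i ↦ ?_, fun i ↦ ?_,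
    fun i ↦ ?_, fun x ↦ ?_, fun x ↦ ?_⟩
  · exact (hBc _ _).diff isOpen_interior.orbitSaturation
  · exact isOpen_connectedComponent.sdiff (hBc _ _).isClosed_orbitSaturation
  · refine sdiff_subset_sdiff ?_ (orbitSaturation_mono (hBi _ _))
    rw [← hBU]
    exact subset_iUnion _ _
  · obtain ⟨g, hg⟩ := hout x
    set c : Q := ⟦x⟧
    rw [← hBU] at hg
    have hex : ∃ m, x ∈ orbitSaturation G (B c.out m) := by
      obtain ⟨m, hm⟩ := mem_iUnion.1 hg
      exact ⟨m, g, hm⟩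
    classical
    obtain ⟨a, ha⟩ := Nat.find_spec hex
    have hmin : ∀ k < Nat.find hex, x ∉ orbitSaturation G (B c.out k) := fun k hk ↦
      Nat.find_min hex hk
    generalize Nat.find hex = m at ha hmin
    match m with
    | 0 => simp [hB0] at ha
    | 1 => simp [hB1] at ha
    | n + 2 =>
      refine ⟨(c, n), a, ha, fun h ↦ hmin (n + 1) (by omega) ?_⟩
      exact orbitSaturation_mono interior_subset (smul_mem_orbitSaturation.1 h)
  · obtain ⟨g, hg⟩ := hout x
    set c : Q := ⟦x⟧
    rw [← hBU] at hg
    obtain ⟨m, hm⟩ := mem_iUnion.1 hg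
    refine ⟨orbitSaturation G (interior (B c.out (m + 1))),
      isOpen_interior.orbitSaturation.mem_nhds ⟨g, hBi _ _ hm⟩, ?_⟩
    refine ((finite_singleton c).prod (finite_Iio (m + 1))).subset ?_
    rintro ⟨c', n⟩ ⟨y, ⟨k, hk, hkn⟩, ⟨l, hl⟩⟩
    have hlC : l • y ∈ connectedComponent c.out := by
      rw [← hBU]
      exact mem_iUnion.2 ⟨_, interior_subset hl⟩
    have hcc : c' = c := by
      have h₁ : (⟦y⟧ : Q) = c' := (Quotient.sound (s := componentOrbitSetoid X G)
        (show (componentOrbitSetoid X G).r y c'.out from ⟨k, (connectedComponent_eq hk).symm⟩)).trans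
        c'.out_eq
      have h₂ : (⟦y⟧ : Q) = c := (Quotient.sound (s := componentOrbitSetoid X G)
        (show (componentOrbitSetoid X G).r y c.out from ⟨l, (connectedComponent_eq hlC).symm⟩)).trans
        c.out_eq
      exact h₁.symm.trans h₂
    subst hcc
    refine ⟨rfl, ?_⟩
    by_contra hn
    have hle : m + 1 ≤ n := not_lt.1 hn
    exact hkn (smul_mem_orbitSaturation.2 ⟨l, hmono _ hle (interior_subset hl)⟩)

end OrbitCover

section InvariantMetric

set_option synthInstance.maxHeartbeats 400000

open MeasureTheory Set Filter Topology Bundle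

universe u

variable {EG : Type*} [NormedAddCommGroup EG] [NormedSpace ℝ EG]
  {G : Type*} [TopologicalSpace G] [ChartedSpace EG G] [Group G]
  {E : Type*} [NormedAddCommGroup E] [NormedSpace ℝ E]
  {P : Type u} [TopologicalSpace P] [ChartedSpace E P] [MulAction G P]

/-- The differential of the action of `g` as a linear equivalence. -/
theorem exists_equiv_mfderiv_smul [LieGroup 𝓘(ℝ, EG) ∞ G] [IsManifold 𝓘(ℝ, E) ∞ P]
    [ContMDiffSMul 𝓘(ℝ, EG) 𝓘(ℝ, E) ∞ G P] (g : G) (p : P) :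
    ∃ D : TangentSpace 𝓘(ℝ, E) p ≃L[ℝ] TangentSpace 𝓘(ℝ, E) (g • p),
      ∀ v, D v = mfderiv 𝓘(ℝ, E) 𝓘(ℝ, E) (fun q : P ↦ g • q) p v :=
  ⟨(Diffeomorph.smul 𝓘(ℝ, EG) 𝓘(ℝ, E) ∞ g).mfderivToContinuousLinearEquiv (by simp) p,
    fun _ ↦ rfl⟩

/-- Near each point of a compact set, one of finitely many compactly supported functions with
support in a given neighbourhood is an immersion. -/
theorem exists_finset_immersive [T2Space P] [FiniteDimensional ℝ E] [IsManifold 𝓘(ℝ, E) ∞ P]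
    {K W : Set P} (hK : IsCompact K) (hW : IsOpen W) (hKW : K ⊆ W) :
    ∃ (t : Finset P) (u : P → P → E), (∀ x ∈ t, ContMDiff 𝓘(ℝ, E) 𝓘(ℝ, E) ∞ (u x)) ∧
      (∀ x ∈ t, HasCompactSupport (u x)) ∧ (∀ x ∈ t, tsupport (u x) ⊆ W) ∧
      ∀ y ∈ K, ∃ x ∈ t, ∀ v, mvfderiv 𝓘(ℝ, E) (u x) y v = 0 → v = 0 := by
  have hf : ∀ x ∈ K, ∃ f : SmoothBumpFunction 𝓘(ℝ, E) x, tsupport f ⊆ W := fun x hx ↦ by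
    obtain ⟨f, -, hf⟩ := (SmoothBumpFunction.nhds_basis_tsupport (I := 𝓘(ℝ, E)) x).mem_iff.1
      (hW.mem_nhds (hKW hx))
    exact ⟨f, hf⟩
  have hf' : ∀ x, ∃ f : SmoothBumpFunction 𝓘(ℝ, E) x, x ∈ K → tsupport f ⊆ W := fun x ↦ by
    by_cases hx : x ∈ K
    · obtain ⟨f, hf⟩ := hf x hx
      exact ⟨f, fun _ ↦ hf⟩
    · exact ⟨Classical.arbitrary _, fun h ↦ (hx h).elim⟩
  choose f hf using hf'
  let N : P → Set P := fun x ↦ {y | ∀ᶠ z in 𝓝 y, f x z = 1} ∩ (chartAt E x).source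
  obtain ⟨t, htK, hKt⟩ := hK.elim_nhds_subcover N fun x _ ↦
    (isOpen_setOfPred_eventually_nhds.inter (chartAt E x).open_source).mem_nhds
      ⟨(f x).eventuallyEq_one, mem_chart_source E x⟩
  refine ⟨t, fun x y ↦ f x y • extChartAt 𝓘(ℝ, E) x y, fun x _ ↦
    (f x).contMDiff_smul contMDiffOn_extChartAt, fun x _ ↦ (f x).hasCompactSupport.smul_right,
    fun x hx ↦ (tsupport_smul_subset_left _ _).trans (hf x (htK x hx)), fun y hy ↦ ?_⟩
  obtain ⟨x, hx, hyx⟩ := mem_iUnion₂.1 (hKt hy)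
  refine ⟨x, hx, fun v hv ↦ ?_⟩
  have heq : (fun z ↦ f x z • extChartAt 𝓘(ℝ, E) x z) =ᶠ[𝓝 y] extChartAt 𝓘(ℝ, E) x := by
    filter_upwards [hyx.1] with z hz
    simp [hz]
  have hv' : mfderiv 𝓘(ℝ, E) 𝓘(ℝ, E) (fun z ↦ f x z • extChartAt 𝓘(ℝ, E) x z) y v = 0 := hv
  rw [heq.mfderiv_eq] at hv'
  obtain ⟨e, he⟩ := isInvertible_mfderiv_extChartAt (I := 𝓘(ℝ, E)) (x := x) (y := y)
    (by rw [extChartAt_source]; exact hyx.2)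
  rw [← he] at hv'
  exact e.map_eq_zero_iff.1 hv'

theorem exists_orbit_immersive_family [LieGroup 𝓘(ℝ, EG) ∞ G] [T2Space P] [ParacompactSpace P]
    [FiniteDimensional ℝ E] [IsManifold 𝓘(ℝ, E) ∞ P] [ContMDiffSMul 𝓘(ℝ, EG) 𝓘(ℝ, E) ∞ G P]
    [ProperSMul G P] :
    ∃ (ι : Type u) (u : ι → P → E), (∀ i, ContMDiff 𝓘(ℝ, E) 𝓘(ℝ, E) ∞ (u i)) ∧
      (∀ i, HasCompactSupport (u i)) ∧
      (∀ (p : P) (v : TangentSpace 𝓘(ℝ, E) p), v ≠ 0 → ∃ (i : ι) (g : G),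
        orbitDeriv (u i) g p v ≠ 0) ∧
      LocallyFinite fun i ↦ orbitSaturation G (tsupport (u i)) := by
  have : LocallyCompactSpace P := Manifold.locallyCompact_of_finiteDimensional 𝓘(ℝ, E)
  have : LocallyConnectedSpace P := ChartedSpace.locallyConnectedSpace E P
  obtain ⟨ι, K, W, hK, hW, hKW, hcov, hlf⟩ := exists_locallyFinite_orbit_cover (G := G) (X := P)
  choose t u hu hc hs him using fun i ↦
    exists_finset_immersive (E := E) (hK i) (hW i) (hKW i)
  refine ⟨Σ i, t i, fun j ↦ u j.1 j.2, fun j ↦ hu _ _ j.2.2, fun j ↦ hc _ _ j.2.2,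
    fun p v hv ↦ ?_, fun p ↦ ?_⟩
  · obtain ⟨i, g, hg⟩ := hcov p
    obtain ⟨x, hx, hinj⟩ := him i _ hg
    refine ⟨⟨i, x, hx⟩, g⁻¹, fun h0 ↦ hv ?_⟩
    obtain ⟨D, hD⟩ := exists_equiv_mfderiv_smul (EG := EG) (E := E) g p
    have hsm : ContMDiff 𝓘(ℝ, E) 𝓘(ℝ, E) ∞ (fun q : P ↦ g • q) :=
      ContMDiffSMul.contMDiff_const_smul (I := 𝓘(ℝ, EG)) g
    have hcomp := mfderiv_comp_apply (x := p)
      ((hu i x hx).mdifferentiableAt (by simp) (x := g • p))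
      (hsm.mdifferentiableAt (by simp) (x := p)) v
    have he : (fun q : P ↦ u i x (g⁻¹⁻¹ • q)) = u i x ∘ fun q : P ↦ g • q := by
      ext q; simp
    have h1 : mvfderiv 𝓘(ℝ, E) (u i x) (g • p) (D v) = 0 := by
      rw [orbitDeriv, he] at h0
      rw [hD]
      exact hcomp.symm.trans h0
    exact D.map_eq_zero_iff.1 (hinj _ h1)
  · obtain ⟨N, hN, hfin⟩ := hlf p
    refine ⟨N, hN, ?_⟩
    refine (hfin.biUnion (t := fun i ↦ range fun x : t i ↦ (⟨i, x⟩ : Σ i, t i))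
      fun i _ ↦ finite_range _).subset ?_
    rintro ⟨i, x⟩ ⟨y, hy, hyN⟩
    exact mem_biUnion (x := i) ⟨y, orbitSaturation_mono (hs _ _ x.2) hy, hyN⟩ ⟨x, rfl⟩

/-- A proper smooth action preserves a smooth field of inner products. -/
theorem exists_invariant_metric [FiniteDimensional ℝ EG] [LieGroup 𝓘(ℝ, EG) ∞ G] [T2Space P]
    [ParacompactSpace P] [FiniteDimensional ℝ E] [IsManifold 𝓘(ℝ, E) ∞ P]
    [ContMDiffSMul 𝓘(ℝ, EG) 𝓘(ℝ, E) ∞ G P] [ProperSMul G P] :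
    ∃ h : ∀ p : P, TangentSpace 𝓘(ℝ, E) p →L[ℝ] TangentSpace 𝓘(ℝ, E) p →L[ℝ] ℝ,
      ContMDiff 𝓘(ℝ, E) (𝓘(ℝ, E).prod 𝓘(ℝ, E →L[ℝ] E →L[ℝ] ℝ)) ∞
        (fun p ↦ TotalSpace.mk' (E →L[ℝ] E →L[ℝ] ℝ) p (h p)) ∧
      (∀ p v w, h p v w = h p w v) ∧ (∀ p v, v ≠ 0 → 0 < h p v v) ∧
      ∀ (g : G) p v w, h (g • p) (mfderiv 𝓘(ℝ, E) 𝓘(ℝ, E) (fun q : P ↦ g • q) p v)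
        (mfderiv 𝓘(ℝ, E) 𝓘(ℝ, E) (fun q : P ↦ g • q) p w) = h p v w := by
  have : IsTopologicalGroup G := topologicalGroup_of_lieGroup 𝓘(ℝ, EG) ∞
  have : LocallyCompactSpace G := Manifold.locallyCompact_of_finiteDimensional 𝓘(ℝ, EG)
  let : MeasurableSpace G := borel G
  have : BorelSpace G := ⟨rfl⟩
  let μ : Measure G := Measure.haar
  obtain ⟨ι, u, hu, hc, him, hlf⟩ := exists_orbit_immersive_family (EG := EG) (G := G) (E := E)
    (P := P)
  obtain ⟨b, hbs, hbp⟩ := exists_pos_symm_form E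
  have hzero : ∀ i p, p ∉ orbitSaturation G (tsupport (u i)) → avgForm μ b (u i) p = 0 :=
    fun i p hp ↦ by
      ext v w
      rw [avgForm_apply (EG := EG) μ b (hu i) (hc i)]
      have : ∀ g : G, orbitDeriv (u i) g p = 0 := fun g ↦
        orbitDeriv_eq_zero fun hg ↦ hp ⟨g⁻¹, hg⟩
      simp [this]
  have hfin : ∀ p, (Function.support fun i ↦ avgForm μ b (u i) p).Finite := fun p ↦
    (hlf.point_finite p).subset fun i hi ↦ by
      by_contra hp
      exact hi (hzero i p hp)
  have happ : ∀ p v w, (∑ᶠ i, avgForm μ b (u i) p) v w = ∑ᶠ i, avgForm μ b (u i) p v w :=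
    fun p v w ↦ by
      let ev : (TangentSpace 𝓘(ℝ, E) p →L[ℝ] TangentSpace 𝓘(ℝ, E) p →L[ℝ] ℝ) →ₗ[ℝ] ℝ :=
        { toFun := fun B ↦ B v w
          map_add' := fun _ _ ↦ rfl
          map_smul' := fun _ _ ↦ rfl }
      exact map_finsum ev (hfin p)
  have hfin' : ∀ p v w, (Function.support fun i ↦ avgForm μ b (u i) p v w).Finite := fun p v w ↦
    (hfin p).subset fun i hi h0 ↦ hi (by simp [h0])
  refine ⟨fun p ↦ ∑ᶠ i, avgForm μ b (u i) p, ?_, fun p v w ↦ ?_, fun p v hv ↦ ?_,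
    fun g p v w ↦ ?_⟩
  · refine ContMDiff.finsum_section_of_locallyFinite (hlf.subset fun i p hp ↦ ?_)
      fun i ↦ contMDiff_avgForm (EG := EG) μ b (hu i) (hc i)
    by_contra h
    exact hp (hzero i p h)
  · rw [happ, happ]
    refine finsum_congr fun i ↦ ?_
    rw [avgForm_apply (EG := EG) μ b (hu i) (hc i), avgForm_apply (EG := EG) μ b (hu i) (hc i)]
    simp only [hbs (orbitDeriv (u i) _ p v)]
  · rw [happ]
    obtain ⟨i, g, hig⟩ := him p v hv
    exact finsum_pos (fun i ↦ avgForm_nonneg (EG := EG) μ b hbp (hu i) (hc i) p v)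
      ⟨i, avgForm_pos (EG := EG) μ b hbp (hu i) (hc i) p v ⟨g, hig⟩⟩ (hfin' p v v)
  · rw [happ, happ]
    exact finsum_congr fun i ↦ avgForm_smul (EG := EG) μ b (hu i) (hc i) g p v w

end InvariantMetric

section Main

open Set Filter Topology Bundle

theorem exists_pos_mul_norm_sq_le {E : Type*} [NormedAddCommGroup E] [NormedSpace ℝ E]
    [FiniteDimensional ℝ E] (B : E →L[ℝ] E →L[ℝ] ℝ) (hB : ∀ v, v ≠ 0 → 0 < B v v) :
    ∃ m > 0, ∀ v, m * ‖v‖ ^ 2 ≤ B v v := by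
  have : ProperSpace E := FiniteDimensional.proper ℝ E
  have hcont : Continuous fun v ↦ B v v := by fun_prop
  rcases (Metric.sphere (0 : E) 1).eq_empty_or_nonempty with hs | hs
  · refine ⟨1, one_pos, fun v ↦ ?_⟩
    rcases eq_or_ne v 0 with rfl | hv
    · simp
    · have : ‖v‖⁻¹ • v ∈ Metric.sphere (0 : E) 1 := by simp [norm_smul, hv]
      simp [hs] at this
  · obtain ⟨w, hw, hmin⟩ := (isCompact_sphere (0 : E) 1).exists_isMinOn hs hcont.continuousOn
    have hw0 : w ≠ 0 := by
      rintro rfl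
      simp at hw
    refine ⟨B w w, hB w hw0, fun v ↦ ?_⟩
    rcases eq_or_ne v 0 with rfl | hv
    · simp
    · have hmem : ‖v‖⁻¹ • v ∈ Metric.sphere (0 : E) 1 := by simp [norm_smul, hv]
      have h₁ : B w w ≤ B (‖v‖⁻¹ • v) (‖v‖⁻¹ • v) := hmin hmem
      have hn : 0 < ‖v‖ := norm_pos_iff.2 hv
      simp only [map_smul, smul_apply, smul_eq_mul] at h₁
      calc B w w * ‖v‖ ^ 2 ≤ (‖v‖⁻¹ * (‖v‖⁻¹ * B v v)) * ‖v‖ ^ 2 := by gcongr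
        _ = B v v := by field_simp

theorem isVonNBounded_of_pos {E : Type*} [NormedAddCommGroup E] [NormedSpace ℝ E]
    [FiniteDimensional ℝ E] {V : Type*} [AddCommGroup V] [Module ℝ V] [TopologicalSpace V]
    [IsTopologicalAddGroup V] [ContinuousSMul ℝ V] (e : V ≃L[ℝ] E) (B : V →L[ℝ] V →L[ℝ] ℝ)
    (hB : ∀ v, v ≠ 0 → 0 < B v v) : Bornology.IsVonNBounded ℝ {v : V | B v v < 1} := by
  obtain ⟨m, hm, hle⟩ := exists_pos_mul_norm_sq_le (formVia e B) fun v hv ↦ by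
    rw [formVia_apply]
    exact hB _ (e.symm.map_ne_zero_iff.2 hv)
  have hbd : Bornology.IsVonNBounded ℝ {x : E | formVia e B x x < 1} := by
    rw [NormedSpace.isVonNBounded_iff, isBounded_iff_forall_norm_le]
    refine ⟨√(m⁻¹), fun x hx ↦ Real.le_sqrt_of_sq_le ?_⟩
    have hx' : m * ‖x‖ ^ 2 ≤ 1 := (hle x).trans hx.le
    rwa [← one_div, le_div_iff₀' hm]
  have hsub : {v : V | B v v < 1} ⊆ (e.symm : E →L[ℝ] V) '' {x : E | formVia e B x x < 1} :=
    fun v hv ↦ ⟨e v, by simpa using hv, by simp⟩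
  exact (hbd.image (e.symm : E →L[ℝ] V)).subset hsub

variable {E : Type*} [NormedAddCommGroup E] [NormedSpace ℝ E]
  {P : Type*} [TopologicalSpace P] [ChartedSpace E P] [IsManifold 𝓘(ℝ, E) ∞ P]

theorem isInnerSymplecticPair_formVia (τ : SymplecticForm E P) {p : P}
    {h : TangentSpace 𝓘(ℝ, E) p →L[ℝ] TangentSpace 𝓘(ℝ, E) p →L[ℝ] ℝ}
    (hs : ∀ v w, h v w = h w v) (hp : ∀ v, v ≠ 0 → 0 < h v v)
    (e : TangentSpace 𝓘(ℝ, E) p ≃L[ℝ] E) :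
    IsInnerSymplecticPair (formVia e h) (formVia e (τ.form p)) where
  symm v w := by simp [hs (e.symm v)]
  pos v hv := by
    rw [formVia_apply]
    exact hp _ (e.symm.map_ne_zero_iff.2 hv)
  alternating v := by simp [τ.alternating]
  nondegenerate v hv := by
    rw [← e.symm.map_eq_zero_iff]
    refine τ.nondegenerate p _ fun w ↦ ?_
    have := hv (e w)
    rwa [formVia_apply, e.symm_apply_apply] at this

/-- The form `(v, w) ↦ τ v (J w)`. -/
noncomputable def twistForm {V : Type*} [AddCommGroup V] [Module ℝ V] [TopologicalSpace V]
    [IsTopologicalAddGroup V] [ContinuousSMul ℝ V] (e : V ≃L[ℝ] E) (τ : V →L[ℝ] V →L[ℝ] ℝ)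
    (J : V →L[ℝ] V) : V →L[ℝ] V →L[ℝ] ℝ :=
  (formVia e).symm ((formVia e τ).bilinearComp (.id ℝ E) (e ∘L J ∘L e.symm))

theorem twistForm_apply {V : Type*} [AddCommGroup V] [Module ℝ V] [TopologicalSpace V]
    [IsTopologicalAddGroup V] [ContinuousSMul ℝ V] (e : V ≃L[ℝ] E) (τ : V →L[ℝ] V →L[ℝ] ℝ)
    (J : V →L[ℝ] V) (v w : V) : twistForm e τ J v w = τ v (J w) := by
  have := formVia_apply e (twistForm e τ J) (e v) (e w)
  rw [twistForm, ContinuousLinearEquiv.apply_symm_apply] at this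
  simpa [twistForm] using this.symm

theorem contDiff_bilinearComp_id :
    ContDiff ℝ ∞ (fun q : (E →L[ℝ] E →L[ℝ] ℝ) × (E →L[ℝ] E) ↦
      q.1.bilinearComp (.id ℝ E) q.2) := by
  have hf : ContDiff ℝ ∞ (ContinuousLinearMap.flip : (E →L[ℝ] E →L[ℝ] ℝ) → E →L[ℝ] E →L[ℝ] ℝ) := by
    rw [← ContinuousLinearMap.coe_flipₗᵢ]
    exact LinearIsometryEquiv.contDiff _
  exact hf.comp ((hf.comp (contDiff_fst.clm_comp contDiff_const)).clm_comp contDiff_snd)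

end Main

theorem mainTheorem10
    {EG : Type*} [NormedAddCommGroup EG] [NormedSpace ℝ EG] [FiniteDimensional ℝ EG]
    {G : Type*} [TopologicalSpace G] [ChartedSpace EG G] [Group G] [LieGroup 𝓘(ℝ, EG) ∞ G]
    {E : Type*} [NormedAddCommGroup E] [NormedSpace ℝ E] [FiniteDimensional ℝ E]
    {P : Type*} [TopologicalSpace P] [T2Space P] [ParacompactSpace P]
    [ChartedSpace E P] [IsManifold 𝓘(ℝ, E) ∞ P]
    [MulAction G P] [ContMDiffSMul 𝓘(ℝ, EG) 𝓘(ℝ, E) ∞ G P] [ProperSMul G P]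
    (τ : SymplecticForm E P) (hτ : τ.IsInvariant G) :
    ∃ J : AlmostComplexStructure E P, J.IsInvariant G ∧ J.IsAdapted τ := by
  obtain ⟨h, hh, hs, hp, hinv⟩ := exists_invariant_metric (EG := EG) (G := G) (E := E) (P := P)
  have H := fun p ↦ isInnerSymplecticPair_formVia τ (hs p) (hp p)
  let J : ∀ p : P, TangentSpace 𝓘(ℝ, E) p →L[ℝ] TangentSpace 𝓘(ℝ, E) p := fun p ↦
    polarVia (tangentModel E p) (h p) (τ.form p)
  have hJ : ∀ p₀ : P, ContMDiffAt 𝓘(ℝ, E) 𝓘(ℝ, E →L[ℝ] E) ∞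
      (fun p ↦ ContinuousLinearMap.inCoordinates E (TangentSpace 𝓘(ℝ, E)) E
        (TangentSpace 𝓘(ℝ, E)) p₀ p p₀ p (J p)) p₀ := fun p₀ ↦ by
    have h₁ := (contMDiffAt_form_iff h p₀).1 (hh p₀)
    have h₂ := (contMDiffAt_form_iff τ.form p₀).1 (τ.contMDiff p₀)
    have hp₀ := mem_chart_source E p₀
    have hpol := (H p₀ (tangentFrame E p₀ hp₀)).contDiffAt_polarComplex
    rw [← inCoordinates_form, ← inCoordinates_form] at hpol
    refine (hpol.contMDiffAt.comp p₀ (h₁.prodMk_space h₂)).congr_of_eventuallyEq ?_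
    filter_upwards [(chartAt E p₀).open_source.mem_nhds hp₀] with p hps
    rw [inCoordinates_endo p₀ hps, Function.comp_apply, inCoordinates_form p₀ hps,
      inCoordinates_form p₀ hps]
    simp only [J, polarVia_eq (tangentModel E p) (tangentFrame E p₀ hps)]
    ext v
    simp [polarVia]
  have hJJ : ∀ p v, J p (J p v) = -v := fun p v ↦ by
    simp [J, polarVia, (H p (tangentModel E p)).polarComplex_polarComplex]
  have hττ : ∀ p v w, τ.form p (J p v) (J p w) = τ.form p v w := fun p v w ↦ by
    have := (H p (tangentModel E p)).apply_polarComplex_polarComplex (tangentModel E p v)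
      (tangentModel E p w)
    simpa [J, polarVia] using this
  have hpos : ∀ p v, v ≠ 0 → 0 < τ.form p v (J p v) := fun p v hv ↦ by
    have := (H p (tangentModel E p)).apply_polarComplex_pos
      ((tangentModel E p).map_ne_zero_iff.2 hv)
    simpa [J, polarVia] using this
  have hsymm : ∀ p v w, τ.form p v (J p w) = τ.form p w (J p v) := fun p v w ↦ by
    have hsk := (H p (tangentModel E p)).skew (tangentModel E p (J p v)) (tangentModel E p w)
    simp only [formVia_apply, ContinuousLinearEquiv.symm_apply_apply] at hsk
    rw [← hττ, hJJ, map_neg, hsk, neg_neg]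
  refine ⟨⟨J, fun p₀ ↦ (contMDiffAt_endo_iff J p₀).2 (hJ p₀), hJJ⟩, fun g p v ↦ ?_, hττ, ?_⟩
  · obtain ⟨D, hD⟩ := exists_equiv_mfderiv_smul (EG := EG) (E := E) g p
    simp only [← hD]
    simp only [J, polarVia_eq (tangentModel E p) (D.trans (tangentModel E (g • p)))]
    exact (polarVia_trans D (tangentModel E (g • p)) (fun v w ↦ by rw [hD, hD]; exact hinv g p v w)
      (fun v w ↦ by rw [hD, hD]; exact hτ g p v w) v).symm
  · refine ⟨⟨fun p ↦ twistForm (tangentModel E p) (τ.form p) (J p), fun p v w ↦ ?_,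
      fun p v hv ↦ ?_, fun p ↦ ?_, fun p₀ ↦ ?_⟩, fun p v w ↦ twistForm_apply _ _ _ v w⟩
    · simp only [twistForm_apply, hsymm p v w]
    · simpa only [twistForm_apply] using hpos p v hv
    · refine isVonNBounded_of_pos (tangentModel E p) _ fun v hv ↦ ?_
      simpa only [twistForm_apply] using hpos p v hv
    · rw [contMDiffAt_form_iff]
      have h₂ := (contMDiffAt_form_iff τ.form p₀).1 (τ.contMDiff p₀)
      refine (contDiff_bilinearComp_id.contDiffAt.contMDiffAt.comp p₀
        (h₂.prodMk_space (hJ p₀))).congr_of_eventuallyEq ?_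
      filter_upwards [(chartAt E p₀).open_source.mem_nhds (mem_chart_source E p₀)] with p hps
      rw [inCoordinates_form p₀ hps, Function.comp_apply, inCoordinates_form p₀ hps,
        inCoordinates_endo p₀ hps]
      ext v w
      simp [twistForm_apply]
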